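/- **Setting.** Let $G$ be a connected simple undirected graph with $n$ nodes, $m$ edges and maximum degree $\Delta$. At each node of degree $\delta$ the incident edges carry distinct port numbers $1,\dots,\delta$ (the two port numbers of an edge are unrelated). There are $k\le n$ robots with distinct, linearly ordered IDs, placed arbitrarily on the nodes. In each synchronous round, the robots at a common node read and rewrite each other's memory, and each of them stays or exits by a port; a robot that moves records the port $\mathit{entered}$ by which it enters its new node. Robots also store $\mathit{settled}$ (initially false), $\mathit{treelabel}$, $\mathit{home}$ (initially $\top$, larger than all IDs), $\mathit{parent}$, $\mathit{child}$, $\mathit{entered}$ (initially $0$, meaning no port) and $\mathit{mult}$ (initially $1$). A node is *free* if it holds no settled robot; at a node that is not free, $r$ denotes its settled robot. Dispersion is achieved when the robots are settled on pairwise distinct nodes. **DFS moves.** Let $x$ be a visitor at a node of degree $\delta$, with $p=x.\mathit{entered}$. The port after $c\le\delta$ is $c+1$, or $c+2$ if $c+1$ is the parent port; a value larger than $\delta$ means that all ports are explored. *Adopting* $r$ means: $r.\mathit{parent}\leftarrow p$, and $r.\mathit{child}\leftarrow$ the port after $0$. *Continuing* at $r$ means: if $p\in\{r.\mathit{parent},r.\mathit{child}\}$,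 then $r.\mathit{child}$ advances to the next port; otherwise nothing is changed and the exit is by $p$. After adopting or advancing, the exit is by $r.\mathit{child}$ if it is at most $\delta$, and by $r.\mathit{parent}$ otherwise. **Algorithm Graph_Disperse(k).** At the start, each robot that is alone at its node settles. Then passes follow, each made of two stages. Both stages run for rounds $0,1,\dots,T$ with $T=\min(4m-2n+2,\,2k\Delta)$. *Stage 1.* At each node with unsettled robots, let $x$ be the one of lowest ID. If the node is free, the unsettled robot of highest ID settles there, gets $\mathit{treelabel}\leftarrow x$ and is adopted, and the other robots exit. Otherwise: if $r.\mathit{treelabel}<x$, all stay; if $r.\mathit{treelabel}=x$, all unsettled robots continue with $x$; if $r.\mathit{treelabel}>x$, then $r.\mathit{treelabel}\leftarrow x$, $r$ is adopted, and all unsettled robots exit. *Between the stages.* Settled robots reset $\mathit{parent}$ and $\mathit{child}$, all robots reset $\mathit{entered}$, and every robot sets $\mathit{mult}$ to the number of robots at its node. At each node with a settled robot $r$ and with unsettled robots, the unsettled robot $x$ of lowest ID sets $x.\mathit{home}\leftarrow r$ and $r.\mathit{treelabel}\leftarrow x$. *Stage 2.* The priority of an unsettled robot is $(\mathit{mult},\mathrm{ID})$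 and that of a settled robot is $(\mathit{mult},\mathit{treelabel})$; higher $\mathit{mult}$ means higher priority, and, for equal $\mathit{mult}$, the lower second entry does. At each node with unsettled robots, let $x$ be the one of highest priority. If the node is free, each visitor goes back by the port it entered. Otherwise: if $r$ has higher priority than $x$, all stay; if $r$ has lower priority, then $r.\mathit{treelabel}\leftarrow x$, $r.\mathit{mult}\leftarrow x.\mathit{mult}$, $r$ is adopted, and all unsettled robots exit; if the priorities are equal, all unsettled robots continue with $x$, except that when $x.\mathit{home}=r$ only $x$ continues, and it stays once all ports of the node are explored. At the end of the stage all variables except $\mathit{settled}$ are reset. **Theorem (displogk).** Let $u_p$ be the number of nodes holding unsettled robots at the start of Stage 1 of pass $p$; equivalently, for $p\ge2$, at the end of Stage 2 of pass $p-1$. For every connected port-labelled graph, every $k\le n$ and every initial placement: 1. $u_{p+1}\le\tfrac12 u_p$ for every pass $p\ge1$. 2. For every pass $p\ge1$ with $p\ge\lfloor\log_2k\rfloor$ (in particular for the last of $\log k$ passes), $u_p\le1$, and Dispersion is achieved at the end of Stage 1 of pass $p$. 3. Algorithm Graph_Disperse(k) solves Dispersion within $\log k$ passes: after $p$ passes,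 for every $p\ge\lfloor\log_2k\rfloor$, Dispersion is achieved. -/

import Mathlib

namespace Dispersion

/-- A port numbering of a graph: at each node `v` of degree `δ` the incident edges carry
distinct labels from `{1, …, δ}`; the two labels of an edge are unrelated. -/
structure PortLabelling {V : Type*} [Fintype V] (G : SimpleGraph V) [DecidableRel G.Adj] where
  label : ∀ v : V, G.neighborSet v ≃ Finset.Icc 1 (G.degree v)

/-- The memory of a robot. Robots are the elements of `Fin k`, ordered by their IDs.
In the port variables `0` stands for "no port". -/
structure Mem (k : ℕ) where
  settled : Bool
  treelabel : WithTop (Fin k)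
  parent : ℕ
  child : ℕ
  /-- the port through which the robot entered its present node -/
  entered : ℕ
  mult : ℕ
  /-- the ID of the settled robot at the home node of the robot -/
  home : WithTop (Fin k)

/-- The initial values of all variables. -/
def Mem.init (k : ℕ) : Mem k :=
  { settled := false, treelabel := ⊤, parent := 0, child := 0, entered := 0, mult := 1, home := ⊤ }

/-- A configuration: positions and memories of the robots. -/
structure Config (V : Type*) (k : ℕ) where
  pos : Fin k → V
  mem : Fin k → Mem k

/-- The element of lowest ID of a set of robots, if there is one. -/
def lowestID {k : ℕ} (A : Finset (Fin k)) : Option (Fin k) :=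
  if h : A.Nonempty then some (A.min' h) else none

/-- The element of highest ID of a set of robots, if there is one. -/
def highestID {k : ℕ} (A : Finset (Fin k)) : Option (Fin k) :=
  if h : A.Nonempty then some (A.max' h) else none

/-! ### One round

What the robots present at one node do in a round is a *local rule*. It sees the degree `δ` of the
node, the set `N` of the robots present there, and their memories `μ`; it returns for each robot
of `N` its new memory and the port by which it exits (`0` if it stays). -/

/-- The type of local rules (joint result of Communicate and Compute at one node). -/
abbrev LocalRule (k : ℕ) : Type :=
  (δ : ℕ) → (N : Finset (Fin k)) → (μ : Fin k → Mem k) → Fin k → Mem k × ℕ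

section Rules

variable {k : ℕ}

/-- The settled robots among those present. -/
def settledOf (N : Finset (Fin k)) (μ : Fin k → Mem k) : Finset (Fin k) :=
  N.filter fun i => (μ i).settled = true

/-- The unsettled robots among those present. -/
def unsettledOf (N : Finset (Fin k)) (μ : Fin k → Mem k) : Finset (Fin k) :=
  N.filter fun i => (μ i).settled = false

/-- The port tried after `child`, at a node of degree `δ`: the next one that is not the parent port.
A value greater than `δ` means that all ports have been taken. -/
def nextPort (δ parent child : ℕ) : ℕ :=
  if child ≤ δ then (if child + 1 = parent then child + 2 else child + 1) else child

/-- The port by which a depth-first search leaves a node: the child port (forward phase),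
or the parent port if all ports have been taken (backtrack phase). -/
def exitPort (δ parent child : ℕ) : ℕ :=
  if child ≤ δ then child else parent

/-- The new `child` of a settled robot with memory `r` that belongs to the search tree of a visitor
who entered through port `p`: it advances if the visitor entered through the parent port or
returned through the child port, and is not altered otherwise. -/
def advance (δ : ℕ) (r : Mem k) (p : ℕ) : ℕ :=
  if p = r.parent ∨ p = r.child then nextPort δ r.parent r.child else r.child

/-- The port by which that visitor goes on; if it entered neither through the parent port nor
through the child port, it has closed a cycle and backtracks through `p`. -/
def continuePort (δ : ℕ) (r : Mem k) (p : ℕ) : ℕ :=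
  if p = r.parent ∨ p = r.child then exitPort δ r.parent (nextPort δ r.parent r.child) else p

/-- Nobody moves and nothing is written. -/
def stay (μ : Fin k → Mem k) (i : Fin k) : Mem k × ℕ := (μ i, 0)

/-- Stage 1 (group dispersion of the unsettled robots). -/
def stage1Rule : LocalRule k := fun δ N μ i =>
  match lowestID (unsettledOf N μ) with
  | none => stay μ i
  | some x =>
    let p := (μ x).entered
    match lowestID (settledOf N μ) with
    | none =>
      -- The node is free: the visitor of highest ID settles.
      if highestID (unsettledOf N μ) = some i then
        ({ μ i with settled := true, treelabel := x, parent := p, child := nextPort δ p 0 }, 0)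
      else (μ i, exitPort δ p (nextPort δ p 0))
    | some r =>
      if (μ r).treelabel < x then stay μ i
      else if (μ r).treelabel = x then
        if i = r then ({ μ r with child := advance δ (μ r) p }, 0)
        else (μ i, continuePort δ (μ r) p)
      else
        if i = r then ({ μ r with treelabel := x, parent := p, child := nextPort δ p 0 }, 0)
        else (μ i, exitPort δ p (nextPort δ p 0))

/-- Lexico-priority: a higher `mult` is a higher priority; if `mult` is the same, a lower
label (or ID) is a higher priority. -/
def priority (mult : ℕ) (label : WithTop (Fin k)) : ℕ ×ₗ (WithTop (Fin k))ᵒᵈ :=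
  toLex (mult, OrderDual.toDual label)

/-- The robot of highest lexico-priority in `A`, if there is one. -/
def highestPriority (μ : Fin k → Mem k) (A : Finset (Fin k)) : Option (Fin k) :=
  lowestID (A.filter fun i => ∀ j ∈ A, (μ j).mult ≤ (μ i).mult)

/-- Stage 2 (traversal of the connected components of settled nodes, to gather the unsettled
robots). -/
def stage2Rule : LocalRule k := fun δ N μ i =>
  match highestPriority μ (unsettledOf N μ) with
  | none => stay μ i
  | some x =>
    let p := (μ x).entered
    match lowestID (settledOf N μ) with
    | none =>
      -- The node is free: each visitor retraces its step.
      (μ i, (μ i).entered)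
    | some r =>
      if priority (μ x).mult x < priority (μ r).mult (μ r).treelabel then stay μ i
      else if priority (μ x).mult x = priority (μ r).mult (μ r).treelabel then
        if i = r then ({ μ r with child := advance δ (μ r) p }, 0)
        else if (μ x).home = r then
          -- At its home node, `x` goes on alone, and only as long as there is an unexplored port.
          if i = x ∧ advance δ (μ r) p ≤ δ then (μ x, continuePort δ (μ r) p) else stay μ i
        else (μ i, continuePort δ (μ r) p)
      else
        if i = r then
          ({ μ r with treelabel := x, mult := (μ x).mult, parent := p, child := nextPort δ p 0 }, 0)
        else (μ i, exitPort δ p (nextPort δ p 0))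

end Rules

section Run

variable {V : Type*} [Fintype V] [DecidableEq V] {G : SimpleGraph V} [DecidableRel G.Adj] {k : ℕ}

/-- Exit `v` by port `p`: the node reached, and its port through which it is entered;
`none` if `p` is not a port of `v` (in particular for `p = 0`). -/
def PortLabelling.exit (L : PortLabelling G) (v : V) (p : ℕ) : Option (V × ℕ) :=
  if h : p ∈ Finset.Icc 1 (G.degree v) then
    let w := (L.label v).symm ⟨p, h⟩
    some (w.1, (L.label w.1 ⟨v, G.adj_symm w.2⟩).1)
  else none

/-- The robots at a node. -/
def Config.at (c : Config V k) (v : V) : Finset (Fin k) :=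
  Finset.univ.filter fun i => c.pos i = v

/-- One synchronous round, in which every node's robots follow the local rule and then move. -/
def round (L : PortLabelling G) (rule : LocalRule k) (c : Config V k) : Config V k where
  pos i :=
    match L.exit (c.pos i) (rule (G.degree (c.pos i)) (c.at (c.pos i)) c.mem i).2 with
    | none => c.pos i
    | some w => w.1
  mem i :=
    let a := rule (G.degree (c.pos i)) (c.at (c.pos i)) c.mem i
    match L.exit (c.pos i) a.2 with
    | none => a.1
    | some w => { a.1 with entered := w.2 }

/-- The start of the algorithm: all variables have their initial values,
except that a robot which is alone at its node is settled. -/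
def start (pos₀ : Fin k → V) : Config V k where
  pos := pos₀
  mem i := { Mem.init k with settled := decide (∀ j, pos₀ j = pos₀ i → j = i) }

/-- Between the stages: settled robots reset `parent` and `child`. All robots set `mult` to the
number of robots at their node. The unsettled robot `x` of lowest ID at a node with settled robot
`r` sets `x.home` to the ID of `r` and `r.treelabel` to its own ID. -/
def prepareStage2 (c : Config V k) : Config V k where
  pos := c.pos
  mem i :=
    let N := c.at (c.pos i)
    let m : Mem k := { c.mem i with entered := 0, mult := N.card }
    match lowestID (unsettledOf N c.mem), lowestID (settledOf N c.mem) with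
    | some x, some r =>
      if i = r then { m with parent := 0, child := 0, treelabel := x }
      else if i = x then { m with home := r }
      else m
    | _, _ => if m.settled then { m with parent := 0, child := 0 } else m

/-- After Stage 2 all variables except `settled` are reset. -/
def finishStage2 (c : Config V k) : Config V k where
  pos := c.pos
  mem i := { Mem.init k with settled := (c.mem i).settled }

variable (L : PortLabelling G)

/-- The bound of the round counter in each of the two stages. -/
def stageBound (G : SimpleGraph V) [DecidableRel G.Adj] (k : ℕ) : ℕ :=
  min (4 * G.edgeFinset.card + 2 - 2 * Fintype.card V) (2 * k * G.maxDegree)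

/-- Stage 1 of a pass: rounds `0, …, stageBound`. -/
def stage1 (c : Config V k) : Config V k :=
  (round L stage1Rule)^[stageBound G k + 1] c

/-- Stage 2 of a pass: rounds `0, …, stageBound`, with the initialisation and the final reset. -/
def stage2 (c : Config V k) : Config V k :=
  finishStage2 ((round L stage2Rule)^[stageBound G k + 1] (prepareStage2 c))

/-- The configuration after `p` passes, from the initial positions `pos₀`. -/
def afterPasses (pos₀ : Fin k → V) (p : ℕ) : Config V k :=
  (fun c => stage2 L (stage1 L c))^[p] (start pos₀)

/-- The configuration at the end of Stage 1 of pass `p` (where `p ≥ 1`). -/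
def afterStage1 (pos₀ : Fin k → V) (p : ℕ) : Config V k :=
  stage1 L (afterPasses L pos₀ (p - 1))

/-- The number of nodes holding unsettled robots. -/
def Config.groups (c : Config V k) : ℕ :=
  (Finset.univ.filter fun v : V => (unsettledOf (c.at v) c.mem).Nonempty).card

/-- Each robot is settled, and the robots are on distinct nodes. -/
def Config.Dispersed (c : Config V k) : Prop :=
  (∀ i, (c.mem i).settled = true) ∧ Function.Injective c.pos

end Run

end Dispersion

/-!
Every group of robots performs a depth-first search of the port-labelled graph, and the searches
interact only through the labels of the settled robots. The proof compares the run with the search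
of a single agent, `Search`, which has no competitors. This search is given a set `S` of nodes that
it explores, and it bounces off all others: in Stage 1 the set `S` contains all nodes, in Stage 2 it
consists of the nodes with a settled robot.

*The single search* (`search_complete`). Each node sends the agent forward at most once through each
of its ports other than the parent port, and each forward move is followed by at most one backward
move. Hence, while the search is not over, the number of moves is at most twice the sum, over the
visited nodes, of the degree, less one for each node other than the root. This is at most
`4m - 2n + 2`, and at most `2kΔ` if no more than `k` nodes are visited. So the search is over after
as many steps as a stage has rounds. It has then visited all nodes linked to the root within `S`
(`Search.Complete.mem_vis_of_linked`).

*Stage 1* (`stage1_end`). Let `x` lead a group that is not settled at the end. As long as `x` has not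
met a label below `x`, it moves like the single search (`Sim1`); other groups may overwrite nodes
that it has visited, but only by lower labels. If this went on to the end, then all `n` nodes would
hold settled robots and `x` would be one more robot, although `k ≤ n`. So `x` has been halted by a
label `y < x`. The robot `y` led another group, and paths of settled nodes lead from the place of `x`
to the starting nodes of both groups (`Traced`).

*Stage 2* (`stage2_gathers`). In a component of the nodes with settled robots, the unsettled robot of
highest priority is never stopped, so it moves like the single search of this component (`Gather`).
Each other robot `z` of the component is caught. When the search leaves a node for good, it has
visited all neighbours of this node in the component, so a robot that enters the node later would
come from a visited node, where it would have been held; nor can it come back from a free node, since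
a node with a free neighbour is not finished by a single visit (`Gather.awaits_step`). Therefore the unsettled
robots of the component are all at the home node of the search in the end.

So each group at the end of a pass stands for a component that contains the starting nodes of two
groups, and the number of groups is halved at least (`two_mul_groups_le`). Since each group at the
start has two robots or more, for `k ≥ 2` at most one group is left when pass `⌊log₂ k⌋` begins,
and a single group has nobody to be halted by (`stage1_dispersed`).
-/

set_option linter.unusedSectionVars false

namespace Dispersion

/-! ### Ports -/

section Ports

variable {V : Type*} [Fintype V] {G : SimpleGraph V} [DecidableRel G.Adj]
  (L : PortLabelling G)

variable {L} in
theorem exit_bounds {v : V} {p : ℕ} {a : V × ℕ} (h : L.exit v p = some a) :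
    1 ≤ p ∧ p ≤ G.degree v := by
  unfold PortLabelling.exit at h
  split_ifs at h with hp
  exact Finset.mem_Icc.1 hp

theorem exists_exit {v : V} {p : ℕ} (h1 : 1 ≤ p) (h2 : p ≤ G.degree v) :
    ∃ w q, L.exit v p = some (w, q) := by
  unfold PortLabelling.exit
  rw [dif_pos (Finset.mem_Icc.2 ⟨h1, h2⟩)]
  exact ⟨_, _, rfl⟩

theorem exit_eq_none {v : V} {p : ℕ} (h : p = 0 ∨ G.degree v < p) : L.exit v p = none := by
  unfold PortLabelling.exit
  rw [dif_neg]
  rw [Finset.mem_Icc]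
  omega

theorem exit_label {v w : V} (h : G.Adj v w) :
    L.exit v (L.label v ⟨w, h⟩).1 = some (w, (L.label w ⟨v, h.symm⟩).1) := by
  unfold PortLabelling.exit
  rw [dif_pos (L.label v ⟨w, h⟩).2]
  have key : ∀ a : G.neighborSet v, a = ⟨w, h⟩ →
      some (a.1, (L.label a.1 ⟨v, G.adj_symm a.2⟩).1) = some (w, (L.label w ⟨v, h.symm⟩).1) := by
    rintro _ rfl
    rfl
  exact key _ (by simp)

variable {L} in
theorem exit_eq_some {v w : V} {p q : ℕ} (h : L.exit v p = some (w, q)) :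
    ∃ hvw : G.Adj v w, p = (L.label v ⟨w, hvw⟩).1 ∧ q = (L.label w ⟨v, hvw.symm⟩).1 := by
  unfold PortLabelling.exit at h
  split_ifs at h with hp
  simp only [Option.some.injEq, Prod.mk.injEq] at h
  obtain ⟨h1, h2⟩ := h
  subst h1
  refine ⟨((L.label v).symm ⟨p, hp⟩).2, ?_, h2.symm⟩
  simp

variable {L} in
theorem exit_adj {v w : V} {p q : ℕ} (h : L.exit v p = some (w, q)) : G.Adj v w :=
  (exit_eq_some h).1

variable {L} in
theorem exit_symm {v w : V} {p q : ℕ} (h : L.exit v p = some (w, q)) :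
    L.exit w q = some (v, p) := by
  obtain ⟨hvw, rfl, rfl⟩ := exit_eq_some h
  exact exit_label L hvw.symm

/-- The node reached from `v` by port `p` and the port of entry; a robot that entered `v` by port
`e` stays there with the same port of entry if `p` is not a port of `v`. -/
def PortLabelling.move (v : V) (e p : ℕ) : V × ℕ := (L.exit v p).getD (v, e)

variable {L} in
theorem move_of_exit {v : V} {p : ℕ} {a : V × ℕ} (e : ℕ) (h : L.exit v p = some a) :
    L.move v e p = a := by
  simp [PortLabelling.move, h]

theorem move_zero (v : V) (e : ℕ) : L.move v e 0 = (v, e) := by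
  simp [PortLabelling.move, exit_eq_none L (Or.inl rfl)]

/-- A move either fails or crosses an edge. -/
theorem move_cases (v : V) (e p : ℕ) :
    L.move v e p = (v, e) ∨ L.exit v p = some (L.move v e p) := by
  unfold PortLabelling.move
  cases h : L.exit v p <;> simp

theorem nextPort_ne_parent (δ a c : ℕ) (hc : c ≤ δ) : nextPort δ a c ≠ a := by
  unfold nextPort
  split_ifs <;> omega

theorem lt_nextPort (δ a c : ℕ) (hc : c ≤ δ) : c < nextPort δ a c := by
  unfold nextPort
  split_ifs <;> omega

/-- The only port that `nextPort` can skip is the parent port. -/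
theorem eq_parent_of_lt_nextPort {δ a c q : ℕ} (h1 : c < q) (h2 : q < nextPort δ a c) : q = a := by
  unfold nextPort at h2
  split_ifs at h2 <;> omega

theorem nextPort_of_lt {δ a c : ℕ} (h : δ < c) : nextPort δ a c = c := by
  unfold nextPort
  rw [if_neg (by omega)]

/-- The number of ports other than the parent port `a` that have been taken when the child port
is `c`. -/
def taken (δ a c : ℕ) : ℕ := ((Finset.Icc 1 δ).filter fun q => q ≤ c ∧ q ≠ a).card

theorem taken_nextPort (δ a c : ℕ) (hc : c ≤ δ) :
    taken δ a (nextPort δ a c) = taken δ a c + if nextPort δ a c ≤ δ then 1 else 0 := by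
  have key : ∀ q, q ≤ nextPort δ a c ∧ q ≠ a ↔ q = nextPort δ a c ∨ (q ≤ c ∧ q ≠ a) := by
    intro q
    have h1 := nextPort_ne_parent δ a c hc
    have h2 := lt_nextPort δ a c hc
    constructor
    · rintro ⟨h3, h4⟩
      by_contra! h5
      exact h4 (eq_parent_of_lt_nextPort (by by_contra h; exact h4 (h5.2 (by omega)))
        (lt_of_le_of_ne h3 h5.1))
    · rintro (rfl | h)
      · exact ⟨le_rfl, h1⟩
      · exact ⟨by omega, h.2⟩
  have h2 := lt_nextPort δ a c hc
  unfold taken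
  simp_rw [key]
  split_ifs with h
  · rw [← Finset.card_insert_of_notMem (a := nextPort δ a c) (by simp; omega)]
    congr 1
    ext q
    simp only [Finset.mem_filter, Finset.mem_insert, Finset.mem_Icc]
    constructor
    · tauto
    · rintro (rfl | h)
      · exact ⟨⟨by omega, h⟩, Or.inl rfl⟩
      · tauto
  · rw [add_zero]
    congr 1
    ext q
    simp only [Finset.mem_filter, Finset.mem_Icc]
    constructor
    · rintro ⟨h3, rfl | h4⟩
      · omega
      · exact ⟨h3, h4⟩
    · tauto

theorem taken_zero (δ a : ℕ) : taken δ a 0 = 0 := by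
  unfold taken
  rw [Finset.card_eq_zero, Finset.filter_eq_empty_iff]
  intro q hq
  rw [Finset.mem_Icc] at hq
  omega

theorem taken_le (δ a c : ℕ) : taken δ a c ≤ δ :=
  (Finset.card_filter_le _ _).trans (by simp)

theorem taken_lt {δ a : ℕ} (c : ℕ) (h1 : 1 ≤ a) (h2 : a ≤ δ) : taken δ a c + 1 ≤ δ := by
  have : taken δ a c ≤ ((Finset.Icc 1 δ).erase a).card := by
    refine Finset.card_le_card fun q hq => ?_
    simp only [Finset.mem_filter, Finset.mem_erase] at *
    tauto
  rw [Finset.card_erase_of_mem (Finset.mem_Icc.2 ⟨h1, h2⟩)] at this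
  simp at this
  omega

end Ports

/-! ### The depth-first search of a single agent -/

/-- The state of the depth-first search of a single agent: the visited nodes with their parent and
child ports, the node of the agent, and the port by which the agent entered it. -/
structure Search (V : Type*) where
  vis : Finset V
  par : V → ℕ
  ch : V → ℕ
  head : V
  ent : ℕ

section Search

variable {V : Type*} [Fintype V] [DecidableEq V] {G : SimpleGraph V} [DecidableRel G.Adj]
  (L : PortLabelling G) (S : Finset V) (root : V)

/-- The search about to begin at `root`. -/
def Search.init : Search V := ⟨∅, fun _ => 0, fun _ => 0, root, 0⟩

/-- The agent leaves a node that it does not explore by the port it entered. -/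
def Search.bounce (s : Search V) : Search V :=
  { s with head := (L.move s.head s.ent s.ent).1, ent := (L.move s.head s.ent s.ent).2 }

/-- The node of the agent becomes visited. -/
def Search.adopt (s : Search V) : Search V :=
  let δ := G.degree s.head
  let c := nextPort δ s.ent 0
  let a := L.move s.head s.ent (exitPort δ s.ent c)
  { vis := insert s.head s.vis
    par := Function.update s.par s.head s.ent
    ch := Function.update s.ch s.head c
    head := a.1
    ent := a.2 }

/-- The agent goes on at a visited node. It remains at the root once all ports have been taken
there. -/
def Search.continue (s : Search V) : Search V :=
  let δ := G.degree s.head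
  let back := s.ent = s.par s.head ∨ s.ent = s.ch s.head
  let c := if back then nextPort δ (s.par s.head) (s.ch s.head) else s.ch s.head
  let p := if s.head = root ∧ δ < c then 0 else
    if back then exitPort δ (s.par s.head) c else s.ent
  let a := L.move s.head s.ent p
  { s with
    ch := Function.update s.ch s.head c
    head := a.1
    ent := a.2 }

/-- One step of the search of the nodes of `S`; the agent bounces off the other nodes. -/
def Search.step (s : Search V) : Search V :=
  if s.head ∈ S then if s.head ∈ s.vis then s.continue L root else s.adopt L else s.bounce L

/-- The search from `root` after `t` steps. -/
def search (t : ℕ) : Search V := (Search.step L S root)^[t] (Search.init root)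

theorem search_succ (t : ℕ) :
    search L S root (t + 1) = (search L S root t).step L S root := by
  simp only [search, Function.iterate_succ_apply']

/-- The structure of the visited nodes. The field `tree` says that the parent ports form a tree, and
that an unfinished node hangs on the current child port of its parent; the field `pending` says what
lies behind the current child port of an unfinished node. -/
structure Search.Inv (s : Search V) : Prop where
  root_mem : root ∈ S
  vis_sub : s.vis ⊆ S
  par_root : root ∈ s.vis → s.par root = 0
  tree : ∃ rank : V → ℕ, ∀ w ∈ s.vis, w ≠ root → ∃ u c, L.exit w (s.par w) = some (u, c) ∧
    u ∈ s.vis ∧ c ≤ s.ch u ∧ rank u < rank w ∧ (s.ch w ≤ G.degree w → s.ch u = c)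
  explored : ∀ w ∈ s.vis, ∀ q u q', q < s.ch w → L.exit w q = some (u, q') → u ∈ S → u ∈ s.vis
  pending : ∀ w ∈ s.vis, ∀ u q, L.exit w (s.ch w) = some (u, q) →
    (s.head = w ∧ s.ent = s.ch w) ∨
    (s.head = u ∧ s.ent = q ∧ ¬ (u ∈ s.vis ∧ s.ch u = q)) ∨
    (u ∈ s.vis ∧ s.par u = q)

/-- The search has not begun. -/
structure Search.Fresh (s : Search V) : Prop where
  vis : s.vis = ∅
  head : s.head = root
  ent : s.ent = 0

/-- The agent has just taken the child port of a visited node. -/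
structure Search.Forward (s : Search V) : Prop where
  root_vis : root ∈ s.vis
  root_open : s.ch root ≤ G.degree root
  from_vis : ∃ w c, L.exit s.head s.ent = some (w, c) ∧ w ∈ s.vis ∧ s.ch w = c
  cross : s.head ∈ s.vis → s.ent ≠ s.par s.head ∧ s.ent ≠ s.ch s.head

/-- The agent has just come back by the child port of its node. -/
structure Search.Returning (s : Search V) : Prop where
  root_vis : root ∈ s.vis
  root_open : s.ch root ≤ G.degree root
  head_vis : s.head ∈ s.vis
  ent_eq : s.ent = s.ch s.head
  head_open : s.ch s.head ≤ G.degree s.head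
  closed : ∀ u q, L.exit s.head s.ent = some (u, q) →
    (u ∈ S → u ∈ s.vis) ∧ (u ∈ s.vis → s.par u = q → G.degree u < s.ch u)

/-- The search is over: the agent is at the root, and all ports of visited nodes have been taken. -/
structure Search.Complete (G : SimpleGraph V) [DecidableRel G.Adj] (s : Search V) : Prop where
  head : s.head = root
  root_vis : root ∈ s.vis
  closed : ∀ w ∈ s.vis, G.degree w < s.ch w

/-- The number of visited nodes that are not finished, that is, still have a child port. -/
def Search.openCard (G : SimpleGraph V) [DecidableRel G.Adj] (s : Search V) : ℕ :=
  (s.vis.filter fun v => s.ch v ≤ G.degree v).card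

/-- The number of forward moves. -/
def Search.forwards (G : SimpleGraph V) [DecidableRel G.Adj] (s : Search V) : ℕ :=
  ∑ v ∈ s.vis, taken (G.degree v) (s.par v) (s.ch v)

/-- The state after `t` steps: each forward move is matched by a later backward move, except those by
the child ports of the nodes that are still open. -/
def Search.Timed (t : ℕ) (s : Search V) : Prop :=
  (s.Fresh root ∧ t = 0) ∨
  (s.Forward L root ∧ t + s.openCard G = 2 * s.forwards G) ∨
  (s.Returning L S root ∧ t + s.openCard G = 2 * s.forwards G + 1) ∨
  s.Complete root G

end Search

/-! ### Progress and termination of the search -/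

section Search

variable {V : Type*} [Fintype V] [DecidableEq V] {G : SimpleGraph V} [DecidableRel G.Adj]
  {L : PortLabelling G} {S : Finset V} {root : V} {s : Search V} {t : ℕ}

theorem Search.inv_init (h : root ∈ S) : (Search.init root).Inv L S root where
  root_mem := h
  vis_sub := by simp [Search.init]
  par_root := by simp [Search.init]
  tree := ⟨fun _ => 0, by simp [Search.init]⟩
  explored := by simp [Search.init]
  pending := by simp [Search.init]

/-- The agent returns through the edge by which it came. -/
theorem Search.Inv.back (hI : s.Inv L S root) (hF : s.Forward L root)
    (hv : s.head ∈ S → s.head ∈ s.vis) {a : V × ℕ} (ha : L.exit s.head s.ent = some a) :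
    ({ s with head := a.1, ent := a.2 } : Search V).Inv L S root ∧
      ({ s with head := a.1, ent := a.2 } : Search V).Returning L S root := by
  obtain ⟨w, c, hw, hwv, hwc⟩ := hF.from_vis
  obtain rfl : a = (w, c) := by rw [ha] at hw; simpa using hw
  have hb := exit_bounds (exit_symm ha)
  refine ⟨⟨hI.root_mem, hI.vis_sub, hI.par_root, hI.tree, hI.explored, ?_⟩,
    ⟨hF.root_vis, hF.root_open, hwv, hwc.symm, by simpa [hwc] using hb.2, ?_⟩⟩
  · intro x hx u q hxu
    rcases hI.pending x hx u q hxu with ⟨h1, h2⟩ | ⟨h1, h2, -⟩ | h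
    · subst h1
      exact absurd h2 (hF.cross hx).2
    · subst h1 h2
      have := exit_symm hxu
      rw [ha] at this
      simp only [Option.some.injEq, Prod.mk.injEq] at this
      exact Or.inl this
    · exact Or.inr (Or.inr h)
  · intro u q hu
    have := exit_symm ha
    simp only at hu
    rw [this] at hu
    simp only [Option.some.injEq, Prod.mk.injEq] at hu
    obtain ⟨rfl, rfl⟩ := hu
    exact ⟨hv, fun h1 h2 => absurd h2.symm (hF.cross h1).1⟩

/-- A new edge leads from the head to `u`; it cannot be the parent or child edge of `u`. -/
theorem Search.Inv.new_edge (hI : s.Inv L S root) {c u q} (hx : L.exit s.head c = some (u, q))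
    (hu : u ∈ s.vis) (h1 : s.head ∈ s.vis → s.ch s.head < c) (h2 : c ≠ s.ent)
    (h3 : s.head ∈ s.vis → c ≠ s.par s.head) : q ≠ s.par u ∧ q ≠ s.ch u := by
  have hq := exit_bounds (exit_symm hx)
  constructor
  · rintro rfl
    have hur : u ≠ root := by
      rintro rfl
      have := hI.par_root hu
      omega
    obtain ⟨rank, hr⟩ := hI.tree
    obtain ⟨u', c', h4, h5, h6, -⟩ := hr u hu hur
    rw [exit_symm hx] at h4
    simp only [Option.some.injEq, Prod.mk.injEq] at h4
    obtain ⟨rfl, rfl⟩ := h4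
    have := h1 h5
    omega
  · rintro rfl
    rcases hI.pending u hu _ _ (exit_symm hx) with ⟨h4, -⟩ | ⟨-, h4, -⟩ | ⟨h4, h5⟩
    · exact (exit_adj hx).ne h4
    · exact h2 h4.symm
    · exact h3 h4 h5.symm

/-- The structure of the visited nodes after an adoption, up to the position of the agent. -/
theorem Search.Inv.adopt_aux (hI : s.Inv L S root) (hS : s.head ∈ S) (hv : s.head ∉ s.vis)
    (hF : s.Fresh root ∨ s.Forward L root) (a : V × ℕ)
    (ha : L.exit s.head (nextPort (G.degree s.head) s.ent 0) = some a ∨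
      G.degree s.head < nextPort (G.degree s.head) s.ent 0) :
    Search.Inv L S root
      { vis := insert s.head s.vis
        par := Function.update s.par s.head s.ent
        ch := Function.update s.ch s.head (nextPort (G.degree s.head) s.ent 0)
        head := a.1
        ent := a.2 } := by
  set c := nextPort (G.degree s.head) s.ent 0 with hc
  have hcne : c ≠ s.ent := nextPort_ne_parent _ _ _ (Nat.zero_le _)
  have hne : ∀ w ∈ s.vis, w ≠ s.head := fun w hw h => hv (h ▸ hw)
  refine ⟨hI.root_mem, ?_, ?_, ?_, ?_, ?_⟩
  · intro w hw
    rcases Finset.mem_insert.1 hw with rfl | hw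
    · exact hS
    · exact hI.vis_sub hw
  · intro _
    rcases hF with hF | hF
    · simp [← hF.head, hF.ent]
    · simp [Function.update_of_ne (hne _ hF.root_vis), hI.par_root hF.root_vis]
  · obtain ⟨rank, hr⟩ := hI.tree
    rcases hF with hF | hF
    · refine ⟨rank, fun w hw hwr => ?_⟩
      rw [hF.vis] at hw
      simp only [insert_empty_eq, Finset.mem_singleton] at hw
      exact absurd (hw.trans hF.head) hwr
    · obtain ⟨u, p, hu, huv, hup⟩ := hF.from_vis
      refine ⟨Function.update rank s.head (rank u + 1), fun w hw hwr => ?_⟩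
      rcases Finset.mem_insert.1 hw with rfl | hw
      · refine ⟨u, p, by simpa using hu, Finset.mem_insert_of_mem huv, ?_, ?_, ?_⟩
        · simp [hne u huv, hup]
        · simp [hne u huv]
        · simp [hne u huv, hup]
      · obtain ⟨u', p', h1, h2, h3, h4, h5⟩ := hr w hw hwr
        refine ⟨u', p', ?_, Finset.mem_insert_of_mem h2, ?_, ?_, ?_⟩
        · simpa [hne w hw] using h1
        · simpa [hne u' h2] using h3
        · simpa [hne w hw, hne u' h2] using h4
        · simpa [hne w hw, hne u' h2] using h5
  · intro w hw q u q' hq hx hu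
    rcases Finset.mem_insert.1 hw with rfl | hw
    · simp only [Function.update_self] at hq
      have hb := exit_bounds hx
      obtain rfl := eq_parent_of_lt_nextPort (by omega) hq
      rcases hF with hF | hF
      · rw [hF.ent] at hb
        omega
      · obtain ⟨u', p', h1, h2, -⟩ := hF.from_vis
        rw [h1] at hx
        simp only [Option.some.injEq, Prod.mk.injEq] at hx
        exact Finset.mem_insert_of_mem (hx.1 ▸ h2)
    · simp only [Function.update_of_ne (hne w hw)] at hq
      exact Finset.mem_insert_of_mem (hI.explored w hw q u q' hq hx hu)
  · intro w hw u q hx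
    rcases Finset.mem_insert.1 hw with rfl | hw
    · simp only [Function.update_self] at hx
      rcases ha with ha | ha
      · rw [hx] at ha
        obtain rfl : (u, q) = a := by simpa using ha
        refine Or.inr (Or.inl ⟨rfl, rfl, ?_⟩)
        rintro ⟨h1, h2⟩
        have hus : u ≠ s.head := (exit_adj hx).ne'
        have huv : u ∈ s.vis := (Finset.mem_insert.1 h1).resolve_left hus
        simp only [Function.update_of_ne hus] at h2
        exact (hI.new_edge hx huv (fun h => absurd h hv) hcne (fun h => absurd h hv)).2 h2.symm
      · have := exit_bounds hx
        omega
    · simp only [Function.update_of_ne (hne w hw)] at hx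
      rcases hI.pending w hw u q hx with ⟨h1, -⟩ | ⟨rfl, h2, -⟩ | ⟨h1, h2⟩
      · exact absurd (h1 ▸ hw) hv
      · exact Or.inr (Or.inr ⟨Finset.mem_insert_self _ _, by simpa using h2⟩)
      · exact Or.inr (Or.inr ⟨Finset.mem_insert_of_mem h1, by simpa [hne u h1] using h2⟩)

theorem Search.openCard_pos (h : root ∈ s.vis) (h' : s.ch root ≤ G.degree root) :
    0 < s.openCard G :=
  Finset.card_pos.2 ⟨root, Finset.mem_filter.2 ⟨h, h'⟩⟩

theorem Search.adopt_step (hI : s.Inv L S root) (hS : s.head ∈ S) (hv : s.head ∉ s.vis)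
    (ht : s.Timed L S root t) (hd : 0 < G.degree root) :
    (s.adopt L).Inv L S root ∧ (s.adopt L).Timed L S root (t + 1) := by
  have hF : s.Fresh root ∨ s.Forward L root := by
    rcases ht with h | h | h | h
    · exact Or.inl h.1
    · exact Or.inr h.1
    · exact absurd h.1.head_vis hv
    · exact absurd (h.head ▸ h.root_vis) hv
  have hne : ∀ w ∈ s.vis, w ≠ s.head := fun w hw h => hv (h ▸ hw)
  have hcne : nextPort (G.degree s.head) s.ent 0 ≠ s.ent :=
    nextPort_ne_parent _ _ _ (Nat.zero_le _)
  have hc0 : 0 < nextPort (G.degree s.head) s.ent 0 := lt_nextPort _ _ _ (Nat.zero_le _)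
  have hT := taken_nextPort (G.degree s.head) s.ent 0 (Nat.zero_le _)
  rw [taken_zero, zero_add] at hT
  have hcount : t + s.openCard G = 2 * s.forwards G := by
    rcases ht with ⟨h, rfl⟩ | h | h | h
    · simp [Search.openCard, Search.forwards, h.vis]
    · exact h.2
    · exact absurd h.1.head_vis hv
    · exact absurd (h.head ▸ h.root_vis) hv
  -- Both counters change only at the head.
  have hfw : (s.adopt L).forwards G =
      s.forwards G + if nextPort (G.degree s.head) s.ent 0 ≤ G.degree s.head then 1 else 0 := by
    simp only [Search.adopt, Search.forwards]
    rw [Finset.sum_insert hv, Function.update_self, Function.update_self, hT, add_comm]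
    congr 1
    refine Finset.sum_congr rfl fun w hw => ?_
    rw [Function.update_of_ne (hne w hw), Function.update_of_ne (hne w hw)]
  have hop : (s.adopt L).openCard G =
      s.openCard G + if nextPort (G.degree s.head) s.ent 0 ≤ G.degree s.head then 1 else 0 := by
    change ((insert s.head s.vis).filter fun v => Function.update s.ch s.head
      (nextPort (G.degree s.head) s.ent 0) v ≤ G.degree v).card = (s.vis.filter _).card + _
    rw [Finset.filter_insert, Function.update_self]
    have : (s.vis.filter fun v => Function.update s.ch s.head
        (nextPort (G.degree s.head) s.ent 0) v ≤ G.degree v) =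
        s.vis.filter fun v => s.ch v ≤ G.degree v :=
      Finset.filter_congr fun w hw => by rw [Function.update_of_ne (hne w hw)]
    rw [this]
    split_ifs
    · rw [Finset.card_insert_of_notMem (by simp [hv])]
    · rfl
  have hroot : (s.adopt L).ch root ≤ G.degree root ∧ root ∈ (s.adopt L).vis := by
    rcases hF with hF | hF
    · simp only [Search.adopt, hF.head, Function.update_self, hF.ent]
      refine ⟨?_, by simp⟩
      simpa [nextPort] using Nat.succ_le_of_lt hd
    · simp only [Search.adopt, Function.update_of_ne (hne _ hF.root_vis)]
      exact ⟨hF.root_open, Finset.mem_insert_of_mem hF.root_vis⟩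
  rcases le_or_gt (nextPort (G.degree s.head) s.ent 0) (G.degree s.head) with hle | hgt
  · obtain ⟨u, q, ha⟩ := exists_exit L hc0 hle
    have hm : L.move s.head s.ent (exitPort (G.degree s.head) s.ent
        (nextPort (G.degree s.head) s.ent 0)) = (u, q) := by
      rw [exitPort, if_pos hle, move_of_exit _ ha]
    refine ⟨?_, Or.inr (Or.inl ⟨⟨hroot.2, hroot.1, ?_, ?_⟩, ?_⟩)⟩
    · have := hI.adopt_aux hS hv hF (u, q) (Or.inl ha)
      simp only [Search.adopt, hm]
      exact this
    · refine ⟨s.head, _, ?_, Finset.mem_insert_self _ _, rfl⟩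
      simp only [Search.adopt, hm, Function.update_self]
      exact exit_symm ha
    · intro hu
      simp only [Search.adopt, hm] at hu ⊢
      have hus : u ≠ s.head := (exit_adj ha).ne'
      rw [Function.update_of_ne hus, Function.update_of_ne hus]
      exact hI.new_edge ha ((Finset.mem_insert.1 hu).resolve_left hus) (fun h => absurd h hv) hcne
        (fun h => absurd h hv)
    · rw [hfw, hop, if_pos hle]
      omega
  · have hF' : s.Forward L root := by
      refine hF.resolve_left fun hF => ?_
      rw [hF.head, hF.ent, nextPort, if_pos (Nat.zero_le _)] at hgt
      simp at hgt
      omega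
    obtain ⟨u, q, ha, huv, huc⟩ := hF'.from_vis
    have hm : L.move s.head s.ent (exitPort (G.degree s.head) s.ent
        (nextPort (G.degree s.head) s.ent 0)) = (u, q) := by
      rw [exitPort, if_neg (by omega), move_of_exit _ ha]
    refine ⟨?_, Or.inr (Or.inr (Or.inl ⟨⟨hroot.2, hroot.1, ?_, ?_, ?_, ?_⟩, ?_⟩))⟩
    · have := hI.adopt_aux hS hv hF (u, q) (Or.inr hgt)
      simp only [Search.adopt, hm]
      exact this
    · simp only [Search.adopt, hm]
      exact Finset.mem_insert_of_mem huv
    · simp only [Search.adopt, hm, Function.update_of_ne (hne u huv)]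
      exact huc.symm
    · have hh : (s.adopt L).head = u := by simp only [Search.adopt, hm]
      rw [hh]
      simp only [Search.adopt, Function.update_of_ne (hne u huv), huc]
      exact (exit_bounds (exit_symm ha)).2
    · intro x y hx
      simp only [Search.adopt, hm] at hx ⊢
      rw [exit_symm ha] at hx
      simp only [Option.some.injEq, Prod.mk.injEq] at hx
      obtain ⟨rfl, rfl⟩ := hx
      simp [hgt]
    · rw [hfw, hop, if_neg (by omega)]
      omega

/-- The structure of the visited nodes after the child port of the head has advanced, up to the
position of the agent. -/
theorem Search.Returning.advance_aux (hI : s.Inv L S root) (hR : s.Returning L S root) (a : V × ℕ)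
    (ha : L.exit s.head (nextPort (G.degree s.head) (s.par s.head) (s.ch s.head)) = some a ∨
      G.degree s.head < nextPort (G.degree s.head) (s.par s.head) (s.ch s.head)) :
    Search.Inv L S root
      { s with
        ch := Function.update s.ch s.head
          (nextPort (G.degree s.head) (s.par s.head) (s.ch s.head))
        head := a.1
        ent := a.2 } := by
  have hlt := lt_nextPort (G.degree s.head) (s.par s.head) (s.ch s.head) hR.head_open
  have hcp := nextPort_ne_parent (G.degree s.head) (s.par s.head) (s.ch s.head) hR.head_open
  set c := nextPort (G.degree s.head) (s.par s.head) (s.ch s.head) with hc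
  refine ⟨hI.root_mem, hI.vis_sub, hI.par_root, ?_, ?_, ?_⟩
  · obtain ⟨rank, hr⟩ := hI.tree
    refine ⟨rank, fun w hw hwr => ?_⟩
    obtain ⟨u, p, h1, h2, h3, h4, h5⟩ := hr w hw hwr
    refine ⟨u, p, h1, h2, ?_, h4, ?_⟩
    · by_cases h : u = s.head
      · subst h
        simp only [Function.update_self]
        omega
      · simpa [h] using h3
    · intro h6
      have huw : u ≠ w := (exit_adj h1).ne'
      by_cases hwh : w = s.head
      · subst hwh
        simp only [Function.update_self] at h6
        simp only [Function.update_of_ne huw]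
        exact h5 (by omega)
      · simp only [Function.update_of_ne hwh] at h6
        by_cases huh : u = s.head
        · subst huh
          -- The child whose subtree has just been left is finished.
          have h7 := h5 h6
          have h8 : L.exit s.head s.ent = some (w, s.par w) := by
            rw [hR.ent_eq, h7]
            exact exit_symm h1
          have := (hR.closed w (s.par w) h8).2 hw rfl
          omega
        · simpa [huh] using h5 h6
  · intro w hw q u q' hq hx hu
    by_cases h : w = s.head
    · subst h
      simp only [Function.update_self] at hq
      rcases lt_trichotomy q (s.ch s.head) with h1 | h1 | h1
      · exact hI.explored _ hw q u q' h1 hx hu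
      · rw [h1, ← hR.ent_eq] at hx
        exact (hR.closed u q' hx).1 hu
      · obtain rfl := eq_parent_of_lt_nextPort h1 hq
        have hb := exit_bounds hx
        have hwr : s.head ≠ root := by
          intro h
          have := hI.par_root hR.root_vis
          rw [h] at hb
          omega
        obtain ⟨rank, hr⟩ := hI.tree
        obtain ⟨u', p, h1, h2, -⟩ := hr _ hw hwr
        rw [hx] at h1
        simp only [Option.some.injEq, Prod.mk.injEq] at h1
        exact h1.1 ▸ h2
    · simp only [Function.update_of_ne h] at hq
      exact hI.explored w hw q u q' hq hx hu
  · intro w hw u q hx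
    by_cases h : w = s.head
    · subst h
      simp only [Function.update_self] at hx
      rcases ha with ha | ha
      · rw [hx] at ha
        obtain rfl : (u, q) = a := by simpa using ha
        refine Or.inr (Or.inl ⟨rfl, rfl, ?_⟩)
        rintro ⟨h1, h2⟩
        have hus : u ≠ s.head := (exit_adj hx).ne'
        simp only [Function.update_of_ne hus] at h2
        refine (hI.new_edge hx h1 (fun _ => hlt) ?_ (fun _ => hcp)).2 h2.symm
        rw [hR.ent_eq]
        omega
      · have := exit_bounds hx
        omega
    · simp only [Function.update_of_ne h] at hx
      rcases hI.pending w hw u q hx with ⟨h1, -⟩ | ⟨rfl, h2, h3⟩ | h1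
      · exact absurd h1.symm h
      · exact absurd ⟨hR.head_vis, by rw [← hR.ent_eq]; exact h2⟩ h3
      · exact Or.inr (Or.inr h1)

theorem Search.advance_step (hI : s.Inv L S root) (hR : s.Returning L S root)
    (ht : t + s.openCard G = 2 * s.forwards G + 1) :
    (s.continue L root).Inv L S root ∧ (s.continue L root).Timed L S root (t + 1) := by
  have hv := hR.head_vis
  have hlt := lt_nextPort (G.degree s.head) (s.par s.head) (s.ch s.head) hR.head_open
  have hcp := nextPort_ne_parent (G.degree s.head) (s.par s.head) (s.ch s.head) hR.head_open
  have hT := taken_nextPort (G.degree s.head) (s.par s.head) (s.ch s.head) hR.head_open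
  have hback : s.ent = s.par s.head ∨ s.ent = s.ch s.head := Or.inr hR.ent_eq
  have hfw : (s.continue L root).forwards G = s.forwards G +
      if nextPort (G.degree s.head) (s.par s.head) (s.ch s.head) ≤ G.degree s.head
        then 1 else 0 := by
    simp only [Search.continue, Search.forwards, if_pos hback]
    rw [← Finset.add_sum_erase _ _ hv, ← Finset.add_sum_erase _ _ hv, Function.update_self, hT,
      add_right_comm]
    congr 2
    refine Finset.sum_congr rfl fun w hw => ?_
    rw [Function.update_of_ne (Finset.ne_of_mem_erase hw)]
  have hop : (s.continue L root).openCard G +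
      (if nextPort (G.degree s.head) (s.par s.head) (s.ch s.head) ≤ G.degree s.head
        then 0 else 1) = s.openCard G := by
    simp only [Search.continue, Search.openCard, if_pos hback]
    split_ifs with h
    · rw [add_zero]
      congr 1
      refine Finset.filter_congr fun w hw => ?_
      by_cases hw : w = s.head
      · subst hw
        simp [h, hR.head_open]
      · rw [Function.update_of_ne hw]
    · have : (s.vis.filter fun v => Function.update s.ch s.head
          (nextPort (G.degree s.head) (s.par s.head) (s.ch s.head)) v ≤ G.degree v) =
          (s.vis.filter fun v => s.ch v ≤ G.degree v).erase s.head := by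
        ext w
        simp only [Finset.mem_filter, Finset.mem_erase]
        by_cases hw : w = s.head
        · subst hw
          simp [h]
        · rw [Function.update_of_ne hw]
          tauto
      rw [this, Finset.card_erase_add_one]
      exact Finset.mem_filter.2 ⟨hv, hR.head_open⟩
  rcases le_or_gt (nextPort (G.degree s.head) (s.par s.head) (s.ch s.head)) (G.degree s.head)
    with hle | hgt
  · obtain ⟨u, q, ha⟩ := exists_exit L (by omega) hle
    have heq : s.continue L root = { s with
        ch := Function.update s.ch s.head
          (nextPort (G.degree s.head) (s.par s.head) (s.ch s.head))
        head := u
        ent := q } := by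
      simp only [Search.continue, if_pos hback]
      rw [if_neg (by omega), exitPort, if_pos hle, move_of_exit _ ha]
    refine ⟨?_, Or.inr (Or.inl ⟨?_, ?_⟩)⟩
    · rw [heq]
      exact hR.advance_aux hI (u, q) (Or.inl ha)
    · rw [heq]
      refine ⟨hR.root_vis, ?_, ⟨s.head, _, exit_symm ha, hv, by simp⟩, ?_⟩
      · by_cases h : root = s.head
        · subst h
          simpa using hle
        · simpa [h] using hR.root_open
      · intro hu
        have hus : u ≠ s.head := (exit_adj ha).ne'
        simp only [Function.update_of_ne hus]
        refine hI.new_edge ha hu (fun _ => hlt) ?_ (fun _ => hcp)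
        rw [hR.ent_eq]
        omega
    · rw [if_pos hle] at hfw hop
      omega
  · by_cases hr : s.head = root
    · have heq : s.continue L root = { s with
          ch := Function.update s.ch s.head
            (nextPort (G.degree s.head) (s.par s.head) (s.ch s.head)) } := by
        simp only [Search.continue, if_pos hback]
        rw [if_pos ⟨hr, hgt⟩, move_zero]
      rw [heq]
      refine ⟨hR.advance_aux hI (s.head, s.ent) (Or.inr hgt), Or.inr (Or.inr (Or.inr ?_))⟩
      refine ⟨hr, hR.root_vis, ?_⟩
      -- An open node of least depth would hang on the last child port of the root.
      have hI' := hR.advance_aux hI (s.head, s.ent) (Or.inr hgt)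
      obtain ⟨rank, hrk⟩ := hI'.tree
      by_contra! hcon
      obtain ⟨w, hw, hmin⟩ := Finset.exists_min_image
        (s.vis.filter fun w => Function.update s.ch s.head
            (nextPort (G.degree s.head) (s.par s.head) (s.ch s.head)) w ≤ G.degree w) rank
        (by obtain ⟨w, h1, h2⟩ := hcon; exact ⟨w, Finset.mem_filter.2 ⟨h1, h2⟩⟩)
      obtain ⟨hwv, hwo⟩ := Finset.mem_filter.1 hw
      have hwr : w ≠ root := by
        rintro rfl
        rw [← hr, Function.update_self] at hwo
        omega
      obtain ⟨u, p, h1, h2, h3, h4, h5⟩ := hrk w hwv hwr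
      have h6 := h5 hwo
      have hp := exit_bounds (exit_symm h1)
      have := hmin u (Finset.mem_filter.2 ⟨h2, by simp only at h6; rw [h6]; exact hp.2⟩)
      omega
    · obtain ⟨rank, hrk⟩ := hI.tree
      obtain ⟨u, p, h1, h2, h3, h4, h5⟩ := hrk s.head hv hr
      have h6 := h5 hR.head_open
      have hus : u ≠ s.head := (exit_adj h1).ne'
      have heq : s.continue L root = { s with
          ch := Function.update s.ch s.head
            (nextPort (G.degree s.head) (s.par s.head) (s.ch s.head))
          head := u
          ent := p } := by
        simp only [Search.continue, if_pos hback]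
        rw [if_neg (by tauto), exitPort, if_neg (by omega), move_of_exit _ h1]
      refine ⟨?_, Or.inr (Or.inr (Or.inl ⟨?_, ?_⟩))⟩
      · rw [heq]
        exact hR.advance_aux hI (u, p) (Or.inr hgt)
      · rw [heq]
        refine ⟨hR.root_vis, ?_, h2, ?_, ?_, ?_⟩
        · simpa [Function.update_of_ne (Ne.symm hr)] using hR.root_open
        · simp [hus, h6]
        · simp only [Function.update_of_ne hus, h6]
          exact (exit_bounds (exit_symm h1)).2
        · intro x y hx
          simp only at hx
          rw [exit_symm h1] at hx
          simp only [Option.some.injEq, Prod.mk.injEq] at hx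
          obtain ⟨rfl, rfl⟩ := hx
          simp [hv, hgt]
      · rw [if_neg (by omega)] at hfw hop
        omega

/-- A search that is over does not change any more. -/
theorem Search.Complete.step_eq (hI : s.Inv L S root) (hC : s.Complete root G) :
    s.step L S root = s := by
  have hv : s.head ∈ s.vis := hC.head ▸ hC.root_vis
  have hgt := hC.closed _ hv
  rw [Search.step, if_pos (hI.vis_sub hv), if_pos hv]
  simp only [Search.continue, nextPort_of_lt hgt, ite_self]
  rw [if_pos ⟨hC.head, hgt⟩, move_zero, Function.update_eq_self]

theorem Search.step_inv (hI : s.Inv L S root) (ht : s.Timed L S root t) (hd : 0 < G.degree root) :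
    (s.step L S root).Inv L S root ∧ (s.step L S root).Timed L S root (t + 1) := by
  by_cases hS : s.head ∈ S
  · by_cases hv : s.head ∈ s.vis
    · rcases ht with ⟨h, -⟩ | ⟨hF, ht⟩ | ⟨hR, ht⟩ | hC
      · rw [h.vis] at hv
        simp at hv
      · have h1 := hF.cross hv
        obtain ⟨w, c, hw, -⟩ := id hF.from_vis
        have hback : ¬ (s.ent = s.par s.head ∨ s.ent = s.ch s.head) := by tauto
        have heq : s.step L S root = { s with head := w, ent := c } := by
          rw [Search.step, if_pos hS, if_pos hv]
          simp only [Search.continue, if_neg hback]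
          rw [if_neg, move_of_exit _ hw, Function.update_eq_self]
          rintro ⟨h2, h3⟩
          have := hF.root_open
          rw [h2] at h3
          omega
        rw [heq]
        obtain ⟨h2, h3⟩ := hI.back hF (fun _ => hv) hw
        exact ⟨h2, Or.inr (Or.inr (Or.inl ⟨h3, by
          simp only [Search.openCard, Search.forwards] at ht ⊢; omega⟩))⟩
      · rw [Search.step, if_pos hS, if_pos hv]
        exact Search.advance_step hI hR ht
      · rw [hC.step_eq hI]
        exact ⟨hI, Or.inr (Or.inr (Or.inr hC))⟩
    · rw [Search.step, if_pos hS, if_neg hv]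
      exact Search.adopt_step hI hS hv ht hd
  · rcases ht with ⟨h, -⟩ | ⟨hF, ht⟩ | ⟨hR, ht⟩ | hC
    · exact absurd (h.head ▸ hI.root_mem) hS
    · obtain ⟨w, c, hw, -⟩ := id hF.from_vis
      have heq : s.step L S root = { s with head := w, ent := c } := by
        rw [Search.step, if_neg hS]
        simp only [Search.bounce, move_of_exit _ hw]
      rw [heq]
      obtain ⟨h2, h3⟩ := hI.back hF (fun h => absurd h hS) hw
      exact ⟨h2, Or.inr (Or.inr (Or.inl ⟨h3, by
          simp only [Search.openCard, Search.forwards] at ht ⊢; omega⟩))⟩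
    · exact absurd (hI.vis_sub hR.head_vis) hS
    · exact absurd (hC.head ▸ hI.root_mem) hS

theorem search_inv (hr : root ∈ S) (hd : 0 < G.degree root) (t : ℕ) :
    (search L S root t).Inv L S root ∧ (search L S root t).Timed L S root t := by
  induction t with
  | zero => exact ⟨Search.inv_init hr, Or.inl ⟨⟨rfl, rfl, rfl⟩, rfl⟩⟩
  | succ t ih =>
    rw [search_succ]
    exact Search.step_inv ih.1 ih.2 hd

/-- Once the search is over, the visited nodes are closed under adjacency in `S`. -/
theorem Search.Complete.mem_vis (hI : s.Inv L S root) (hC : s.Complete root G) {v w : V}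
    (hv : v ∈ s.vis) (hvw : G.Adj v w) (hw : w ∈ S) : w ∈ s.vis := by
  have h := exit_label L hvw
  have := exit_bounds h
  have := hC.closed v hv
  exact hI.explored v hv _ _ _ (by omega) h hw

/-- The search is over after as many steps as a stage has rounds. -/
theorem search_complete (hr : root ∈ S) (hd : ∀ v, 0 < G.degree v) {k : ℕ}
    (hk : (search L S root (stageBound G k + 1)).vis.card ≤ k) :
    (search L S root (stageBound G k + 1)).Complete root G := by
  obtain ⟨hI, hT⟩ := search_inv (L := L) hr (hd root) (stageBound G k + 1)
  set s := search L S root (stageBound G k + 1)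
  by_contra hC
  have h1 : root ∈ s.vis ∧ stageBound G k + 1 ≤ 2 * s.forwards G := by
    rcases hT with ⟨-, h⟩ | ⟨h, h'⟩ | ⟨h, h'⟩ | h
    · omega
    · have := Search.openCard_pos h.root_vis h.root_open
      exact ⟨h.root_vis, by omega⟩
    · have := Search.openCard_pos h.root_vis h.root_open
      exact ⟨h.root_vis, by omega⟩
    · exact absurd h hC
  obtain ⟨hrv, h1⟩ := h1
  have hA : s.forwards G ≤ k * G.maxDegree := by
    calc s.forwards G ≤ ∑ v ∈ s.vis, G.maxDegree :=
          Finset.sum_le_sum fun v _ => (taken_le _ _ _).trans (G.degree_le_maxDegree v)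
      _ = s.vis.card * G.maxDegree := by simp
      _ ≤ k * G.maxDegree := Nat.mul_le_mul_right _ hk
  have hB : s.forwards G + Fintype.card V ≤ 2 * G.edgeFinset.card + 1 := by
    rw [← G.sum_degrees_eq_twice_card_edges]
    have h2 : ∀ v ∈ s.vis, v ≠ root →
        taken (G.degree v) (s.par v) (s.ch v) + 1 ≤ G.degree v := by
      intro v hv hvr
      obtain ⟨rank, h⟩ := hI.tree
      obtain ⟨u, c, hu, -⟩ := h v hv hvr
      have := exit_bounds hu
      exact taken_lt _ this.1 this.2
    have h3 : ∑ v : V, ((if v ∈ s.vis then taken (G.degree v) (s.par v) (s.ch v) else 0) + 1) ≤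
        ∑ v : V, (G.degree v + if v = root then 1 else 0) := by
      refine Finset.sum_le_sum fun v _ => ?_
      have := hd v
      have := taken_le (G.degree v) (s.par v) (s.ch v)
      split_ifs with h4 h5 h5
      · omega
      · have := h2 v h4 h5
        omega
      · omega
      · omega
    rw [Finset.sum_add_distrib, Finset.sum_add_distrib] at h3
    simpa [Search.forwards] using h3
  have h4 : stageBound G k ≤ 4 * G.edgeFinset.card + 2 - 2 * Fintype.card V := min_le_left _ _
  have h5 : stageBound G k ≤ 2 * k * G.maxDegree := min_le_right _ _
  have h6 : stageBound G k = 4 * G.edgeFinset.card + 2 - 2 * Fintype.card V ∨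
      stageBound G k = 2 * k * G.maxDegree := min_choice _ _
  rw [mul_assoc] at h6
  omega

end Search

/-! ### One round of a configuration -/

section Rounds

variable {V : Type*} [Fintype V] [DecidableEq V] {G : SimpleGraph V} [DecidableRel G.Adj]
  {L : PortLabelling G} {k : ℕ} {c : Config V k}

theorem lowestID_eq_some {A : Finset (Fin k)} {x : Fin k} :
    lowestID A = some x ↔ x ∈ A ∧ ∀ y ∈ A, x ≤ y := by
  unfold lowestID
  split_ifs with h
  · rw [Option.some.injEq]
    constructor
    · rintro rfl
      exact ⟨A.min'_mem h, fun y hy => A.min'_le y hy⟩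
    · rintro ⟨h1, h2⟩
      exact le_antisymm (A.min'_le x h1) (A.le_min' h x h2)
  · rw [Finset.not_nonempty_iff_eq_empty] at h
    simp [h]

theorem lowestID_eq_none {A : Finset (Fin k)} : lowestID A = none ↔ A = ∅ := by
  unfold lowestID
  split_ifs with h
  · simpa using h.ne_empty
  · simpa using Finset.not_nonempty_iff_eq_empty.1 h

theorem highestID_eq_some {A : Finset (Fin k)} {x : Fin k} :
    highestID A = some x ↔ x ∈ A ∧ ∀ y ∈ A, y ≤ x := by
  unfold highestID
  split_ifs with h
  · rw [Option.some.injEq]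
    constructor
    · rintro rfl
      exact ⟨A.max'_mem h, fun y hy => A.le_max' y hy⟩
    · rintro ⟨h1, h2⟩
      exact le_antisymm (A.max'_le h x h2) (A.le_max' x h1)
  · rw [Finset.not_nonempty_iff_eq_empty] at h
    simp [h]

theorem mem_at {v : V} {i : Fin k} : i ∈ c.at v ↔ c.pos i = v := by
  simp [Config.at]

theorem mem_settledOf {v : V} {i : Fin k} :
    i ∈ settledOf (c.at v) c.mem ↔ (c.mem i).settled = true ∧ c.pos i = v := by
  simp [settledOf, mem_at, and_comm]

theorem mem_unsettledOf {v : V} {i : Fin k} :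
    i ∈ unsettledOf (c.at v) c.mem ↔ (c.mem i).settled = false ∧ c.pos i = v := by
  simp [unsettledOf, mem_at, and_comm]

/-- No two settled robots share a node. -/
def Config.Proper (c : Config V k) : Prop :=
  ∀ i j, (c.mem i).settled = true → (c.mem j).settled = true → c.pos i = c.pos j → i = j

/-- The nodes that hold settled robots. -/
def Config.hosts (c : Config V k) : Finset V :=
  (Finset.univ.filter fun i => (c.mem i).settled = true).image c.pos

theorem mem_hosts {v : V} : v ∈ c.hosts ↔ ∃ r, (c.mem r).settled = true ∧ c.pos r = v := by
  simp [Config.hosts]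

theorem card_hosts_le : c.hosts.card ≤ k :=
  Finset.card_image_le.trans ((Finset.card_filter_le _ _).trans (by simp))

theorem card_hosts_lt {x : Fin k} (hx : (c.mem x).settled = false) : c.hosts.card < k := by
  have : (Finset.univ.filter fun i => (c.mem i).settled = true).card <
      (Finset.univ : Finset (Fin k)).card :=
    Finset.card_lt_card (Finset.filter_ssubset.2 ⟨x, Finset.mem_univ _, by simp [hx]⟩)
  exact Finset.card_image_le.trans_lt (by simpa using this)

theorem lowestID_settledOf (hP : c.Proper) {r : Fin k} (hr : (c.mem r).settled = true) {v : V}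
    (hv : c.pos r = v) : lowestID (settledOf (c.at v) c.mem) = some r := by
  rw [lowestID_eq_some]
  refine ⟨mem_settledOf.2 ⟨hr, hv⟩, fun y hy => ?_⟩
  obtain ⟨h1, h2⟩ := mem_settledOf.1 hy
  exact (hP r y hr h1 (hv.trans h2.symm)).le

theorem lowestID_settledOf_free {v : V} (hv : v ∉ c.hosts) :
    lowestID (settledOf (c.at v) c.mem) = none := by
  rw [lowestID_eq_none, Finset.eq_empty_iff_forall_notMem]
  intro r hr
  exact hv (mem_hosts.2 ⟨r, mem_settledOf.1 hr⟩)

theorem round_pos (rule : LocalRule k) (i : Fin k) {a : Mem k × ℕ}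
    (ha : rule (G.degree (c.pos i)) (c.at (c.pos i)) c.mem i = a) :
    (round L rule c).pos i = (L.move (c.pos i) a.1.entered a.2).1 := by
  subst ha
  simp only [round, PortLabelling.move]
  split <;> rename_i h <;> rw [h] <;> rfl

theorem round_mem (rule : LocalRule k) (i : Fin k) {a : Mem k × ℕ}
    (ha : rule (G.degree (c.pos i)) (c.at (c.pos i)) c.mem i = a) :
    (round L rule c).mem i =
      { a.1 with entered := (L.move (c.pos i) a.1.entered a.2).2 } := by
  subst ha
  simp only [round, PortLabelling.move]
  split <;> rename_i h <;> rw [h] <;> rfl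

/-- `u` and `v` are joined by a path within `S`. -/
def Linked (G : SimpleGraph V) (S : Finset V) (u v : V) : Prop :=
  u ∈ S ∧ Relation.ReflTransGen (fun a b => a ∈ S ∧ b ∈ S ∧ G.Adj a b) u v

theorem Linked.refl {S : Finset V} {u : V} (h : u ∈ S) : Linked G S u u :=
  ⟨h, Relation.ReflTransGen.refl⟩

theorem Linked.right {S : Finset V} {u v : V} (h : Linked G S u v) : v ∈ S := by
  rcases Relation.ReflTransGen.cases_tail h.2 with h1 | ⟨w, -, h1⟩
  · exact h1 ▸ h.1
  · exact h1.2.1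

theorem Linked.symm {S : Finset V} {u v : V} (h : Linked G S u v) : Linked G S v u := by
  refine ⟨h.right, ?_⟩
  obtain ⟨-, h⟩ := h
  induction h with
  | refl => exact .refl
  | tail _ h ih => exact .head ⟨h.2.1, h.1, h.2.2.symm⟩ ih

theorem Linked.trans {S : Finset V} {u v w : V} (h : Linked G S u v) (h' : Linked G S v w) :
    Linked G S u w :=
  ⟨h.1, h.2.trans h'.2⟩

theorem Linked.tail {S : Finset V} {u v w : V} (h : Linked G S u v) (h' : G.Adj v w)
    (hw : w ∈ S) : Linked G S u w :=
  ⟨h.1, h.2.tail ⟨h.right, hw, h'⟩⟩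

theorem Linked.mono {S S' : Finset V} {u v : V} (h : Linked G S u v) (hS : S ⊆ S') :
    Linked G S' u v :=
  ⟨hS h.1, Relation.ReflTransGen.mono (fun _ _ h => ⟨hS h.1, hS h.2.1, h.2.2⟩) _ _ h.2⟩

/-- A search that is over has visited every node linked to its root. -/
theorem Search.Complete.mem_vis_of_linked {S : Finset V} {root v : V} {s : Search V}
    (hI : s.Inv L S root) (hC : s.Complete root G) (h : Linked G S root v) : v ∈ s.vis := by
  obtain ⟨-, h⟩ := h
  induction h with
  | refl => exact hC.root_vis
  | tail _ h ih => exact hC.mem_vis hI ih h.2.2 h.2.1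

/-- As long as the search is not over, the agent leaves a visited node like a visitor of Stage 1. -/
theorem Search.continue_eq {S : Finset V} {root : V} {s : Search V} {t : ℕ}
    (hI : s.Inv L S root) (ht : s.Timed L S root t) (hC : ¬ s.Complete root G)
    (hv : s.head ∈ s.vis) (m : Mem k) (hp : m.parent = s.par s.head)
    (hc : m.child = s.ch s.head) :
    s.continue L root = { s with
      ch := Function.update s.ch s.head (advance (G.degree s.head) m s.ent)
      head := (L.move s.head s.ent (continuePort (G.degree s.head) m s.ent)).1
      ent := (L.move s.head s.ent (continuePort (G.degree s.head) m s.ent)).2 } := by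
  simp only [Search.continue, advance, continuePort, hp, hc]
  by_cases hr : s.head = root ∧ G.degree s.head <
      if s.ent = s.par s.head ∨ s.ent = s.ch s.head then
        nextPort (G.degree s.head) (s.par s.head) (s.ch s.head) else s.ch s.head
  · rw [if_pos hr]
    obtain ⟨h1, h2⟩ := hr
    have hR : s.Returning L S root := by
      rcases ht with h | h | h | h
      · exact absurd hv (by simp [h.1.vis])
      · have := h.1.cross hv
        rw [if_neg (by tauto)] at h2
        have := h.1.root_open
        rw [h1] at h2
        omega
      · exact h.1
      · exact absurd h hC
    rw [if_pos (Or.inr hR.ent_eq)] at h2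
    rw [if_pos (Or.inr hR.ent_eq), if_pos (Or.inr hR.ent_eq), exitPort, if_neg (by omega)]
    have : s.par s.head = 0 := by rw [h1]; exact hI.par_root hR.root_vis
    rw [this]
  · rw [if_neg hr]
    split_ifs <;> rfl

end Rounds

/-! ### Stage 1 -/

section Stage1

variable {V : Type*} [Fintype V] [DecidableEq V] {G : SimpleGraph V} [DecidableRel G.Adj]
  {L : PortLabelling G} {k : ℕ} {c : Config V k} {x i r : Fin k}

/-- `x` has the lowest ID among the unsettled robots of its node. -/
def Config.Leads (c : Config V k) (x : Fin k) : Prop :=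
  (c.mem x).settled = false ∧ ∀ y, c.pos y = c.pos x → (c.mem y).settled = false → x ≤ y

theorem exists_leads (hi : (c.mem i).settled = false) : ∃ x, c.Leads x ∧ c.pos x = c.pos i := by
  obtain ⟨x, hx, hmin⟩ := Finset.exists_min_image
    (Finset.univ.filter fun y => c.pos y = c.pos i ∧ (c.mem y).settled = false) id
    ⟨i, by simp [hi]⟩
  simp only [Finset.mem_filter, Finset.mem_univ, true_and, id] at hx hmin
  exact ⟨x, ⟨hx.2, fun y h1 h2 => hmin y ⟨h1.trans hx.1, h2⟩⟩, hx.1⟩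

theorem Config.Leads.unique {y : Fin k} (hx : c.Leads x) (hy : c.Leads y) (h : c.pos x = c.pos y) :
    x = y :=
  le_antisymm (hx.2 y h.symm hy.1) (hy.2 x h hx.1)

theorem Config.Leads.lowestID (hx : c.Leads x) {v : V} (hv : c.pos x = v) :
    lowestID (unsettledOf (c.at v) c.mem) = some x := by
  subst hv
  rw [lowestID_eq_some]
  refine ⟨mem_unsettledOf.2 ⟨hx.1, rfl⟩, fun y hy => ?_⟩
  obtain ⟨h1, h2⟩ := mem_unsettledOf.1 hy
  exact hx.2 y h2 h1

theorem stage1Rule_none (h : ∀ y, c.pos y = c.pos i → (c.mem y).settled = true) (δ : ℕ) :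
    stage1Rule δ (c.at (c.pos i)) c.mem i = (c.mem i, 0) := by
  have : lowestID (unsettledOf (c.at (c.pos i)) c.mem) = none := by
    rw [lowestID_eq_none, Finset.eq_empty_iff_forall_notMem]
    intro y hy
    obtain ⟨h1, h2⟩ := mem_unsettledOf.1 hy
    simp [h y h2] at h1
  simp [stage1Rule, this, stay]

theorem stage1Rule_free (hx : c.Leads x) (hi : c.pos i = c.pos x) (hf : c.pos x ∉ c.hosts)
    (δ : ℕ) :
    stage1Rule δ (c.at (c.pos i)) c.mem i =
      if highestID (unsettledOf (c.at (c.pos x)) c.mem) = some i then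
        ({ c.mem i with
            settled := true
            treelabel := x
            parent := (c.mem x).entered
            child := nextPort δ (c.mem x).entered 0 }, 0)
      else (c.mem i, exitPort δ (c.mem x).entered (nextPort δ (c.mem x).entered 0)) := by
  rw [hi]
  simp only [stage1Rule, hx.lowestID rfl, lowestID_settledOf_free hf]

theorem stage1Rule_host (hP : c.Proper) (hx : c.Leads x) (hi : c.pos i = c.pos x)
    (hr : (c.mem r).settled = true) (hrx : c.pos r = c.pos x) (δ : ℕ) :
    stage1Rule δ (c.at (c.pos i)) c.mem i =
      if (c.mem r).treelabel < x then (c.mem i, 0)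
      else if (c.mem r).treelabel = x then
        if i = r then ({ c.mem r with child := advance δ (c.mem r) (c.mem x).entered }, 0)
        else (c.mem i, continuePort δ (c.mem r) (c.mem x).entered)
      else
        if i = r then
          ({ c.mem r with
              treelabel := x
              parent := (c.mem x).entered
              child := nextPort δ (c.mem x).entered 0 }, 0)
        else (c.mem i, exitPort δ (c.mem x).entered (nextPort δ (c.mem x).entered 0)) := by
  rw [hi]
  simp only [stage1Rule, hx.lowestID rfl, lowestID_settledOf hP hr hrx, stay]

/-- What a round of Stage 1 does to a settled robot: nothing, or it serves the visitors led by the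
owner of its label, or it is adopted by a leader of lower ID. -/
theorem stage1_settled (hP : c.Proper) (hr : (c.mem r).settled = true) :
    (round L stage1Rule c).pos r = c.pos r ∧
    ((round L stage1Rule c).mem r).settled = true ∧
    (((round L stage1Rule c).mem r = c.mem r ∧
        ∀ x, c.Leads x → c.pos x = c.pos r → (c.mem r).treelabel < x) ∨
      ∃ x, c.Leads x ∧ c.pos x = c.pos r ∧ ((round L stage1Rule c).mem r).treelabel = x ∧
        (((c.mem r).treelabel = x ∧
          ((round L stage1Rule c).mem r).parent = (c.mem r).parent ∧
          ((round L stage1Rule c).mem r).child =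
            advance (G.degree (c.pos r)) (c.mem r) (c.mem x).entered) ∨
        ((x : WithTop (Fin k)) < (c.mem r).treelabel ∧
          ((round L stage1Rule c).mem r).parent = (c.mem x).entered ∧
          ((round L stage1Rule c).mem r).child =
            nextPort (G.degree (c.pos r)) (c.mem x).entered 0))) := by
  by_cases hu : ∃ y, c.pos y = c.pos r ∧ (c.mem y).settled = false
  · obtain ⟨y, hy, hy'⟩ := hu
    obtain ⟨x, hx, hxy⟩ := exists_leads hy'
    have hxr : c.pos r = c.pos x := (hxy.trans hy).symm
    have h := stage1Rule_host hP hx hxr hr hxr (G.degree (c.pos r))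
    rw [if_pos rfl, if_pos rfl] at h
    rcases lt_trichotomy (c.mem r).treelabel (x : WithTop (Fin k)) with h1 | h1 | h1
    · rw [if_pos h1] at h
      rw [round_pos _ _ h, round_mem _ _ h, move_zero]
      refine ⟨rfl, hr, Or.inl ⟨rfl, fun x' hx' h' => ?_⟩⟩
      rwa [hx'.unique hx (h'.trans hxr)]
    · rw [if_neg h1.not_lt, if_pos h1] at h
      rw [round_pos _ _ h, round_mem _ _ h, move_zero]
      exact ⟨rfl, hr, Or.inr ⟨x, hx, hxr.symm, h1, Or.inl ⟨h1, rfl, rfl⟩⟩⟩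
    · rw [if_neg h1.not_gt, if_neg h1.ne'] at h
      rw [round_pos _ _ h, round_mem _ _ h, move_zero]
      exact ⟨rfl, hr, Or.inr ⟨x, hx, hxr.symm, rfl, Or.inr ⟨h1, rfl, rfl⟩⟩⟩
  · push Not at hu
    have h := stage1Rule_none (i := r) (fun y hy => by simpa using hu y hy) (G.degree (c.pos r))
    rw [round_pos _ _ h, round_mem _ _ h, move_zero]
    refine ⟨rfl, hr, Or.inl ⟨rfl, fun x hx h' => ?_⟩⟩
    exact absurd hx.1 (hu x h')

/-- What a round of Stage 1 does to the visitors of a free node: the one of highest ID settles. -/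
theorem stage1_free (hx : c.Leads x) (hi : (c.mem i).settled = false) (hix : c.pos i = c.pos x)
    (hf : c.pos x ∉ c.hosts) :
    ((∀ y, c.pos y = c.pos x → (c.mem y).settled = false → y ≤ i) ∧
      (round L stage1Rule c).pos i = c.pos i ∧
      ((round L stage1Rule c).mem i).settled = true ∧
      ((round L stage1Rule c).mem i).treelabel = x ∧
      ((round L stage1Rule c).mem i).parent = (c.mem x).entered ∧
      ((round L stage1Rule c).mem i).child =
        nextPort (G.degree (c.pos i)) (c.mem x).entered 0) ∨
    ((∃ y, c.pos y = c.pos x ∧ (c.mem y).settled = false ∧ i < y) ∧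
      ((round L stage1Rule c).mem i).settled = false ∧
      (round L stage1Rule c).pos i = (L.move (c.pos x) (c.mem i).entered
        (exitPort (G.degree (c.pos x)) (c.mem x).entered
          (nextPort (G.degree (c.pos x)) (c.mem x).entered 0))).1 ∧
      ((round L stage1Rule c).mem i).entered = (L.move (c.pos x) (c.mem i).entered
        (exitPort (G.degree (c.pos x)) (c.mem x).entered
          (nextPort (G.degree (c.pos x)) (c.mem x).entered 0))).2) := by
  have h := stage1Rule_free hx hix hf (G.degree (c.pos i))
  by_cases hh : highestID (unsettledOf (c.at (c.pos x)) c.mem) = some i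
  · rw [if_pos hh] at h
    rw [round_pos _ _ h, round_mem _ _ h, move_zero]
    refine Or.inl ⟨fun y h1 h2 => ?_, rfl, rfl, rfl, rfl, rfl⟩
    exact (highestID_eq_some.1 hh).2 y (mem_unsettledOf.2 ⟨h2, h1⟩)
  · rw [if_neg hh] at h
    rw [round_pos _ _ h, round_mem _ _ h]
    refine Or.inr ⟨?_, hi, by rw [hix], by rw [hix]⟩
    by_contra! hcon
    refine hh (highestID_eq_some.2 ⟨mem_unsettledOf.2 ⟨hi, hix⟩, fun y hy => ?_⟩)
    obtain ⟨h1, h2⟩ := mem_unsettledOf.1 hy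
    exact hcon y h2 h1

/-- The port by which the visitors led by `x` leave a node whose settled robot has memory `m`. -/
def hostPort (δ : ℕ) (m : Mem k) (x : Fin k) (p : ℕ) : ℕ :=
  if m.treelabel < x then 0 else if m.treelabel = x then continuePort δ m p
  else exitPort δ p (nextPort δ p 0)

theorem stage1_host (hP : c.Proper) (hx : c.Leads x) (hi : (c.mem i).settled = false)
    (hix : c.pos i = c.pos x) (hr : (c.mem r).settled = true) (hrx : c.pos r = c.pos x) :
    ((round L stage1Rule c).mem i).settled = false ∧
    (round L stage1Rule c).pos i = (L.move (c.pos x) (c.mem i).entered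
      (hostPort (G.degree (c.pos x)) (c.mem r) x (c.mem x).entered)).1 ∧
    ((round L stage1Rule c).mem i).entered = (L.move (c.pos x) (c.mem i).entered
      (hostPort (G.degree (c.pos x)) (c.mem r) x (c.mem x).entered)).2 := by
  have hir : i ≠ r := by
    rintro rfl
    simp [hi] at hr
  have h : stage1Rule (G.degree (c.pos i)) (c.at (c.pos i)) c.mem i =
      (c.mem i, hostPort (G.degree (c.pos x)) (c.mem r) x (c.mem x).entered) := by
    rw [stage1Rule_host hP hx hix hr hrx, hostPort, if_neg hir, if_neg hir]
    rw [hix]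
    split_ifs <;> rfl
  rw [round_pos _ _ h, round_mem _ _ h]
  exact ⟨hi, by rw [hix], by rw [hix]⟩

theorem fst_move_congr (v : V) (e e' p : ℕ) : (L.move v e p).1 = (L.move v e' p).1 := by
  unfold PortLabelling.move
  cases L.exit v p <;> rfl

theorem stage1_unsettled_of (hP : c.Proper)
    (hi : ((round L stage1Rule c).mem i).settled = false) : (c.mem i).settled = false := by
  by_contra h
  have := (stage1_settled (L := L) hP (by simpa using h)).2.1
  rw [hi] at this
  cases this

/-- Unsettled robots of one node that remain unsettled move together. -/
theorem stage1_together (hP : c.Proper) {i j : Fin k} (hij : c.pos i = c.pos j)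
    (hi : ((round L stage1Rule c).mem i).settled = false)
    (hj : ((round L stage1Rule c).mem j).settled = false) :
    (round L stage1Rule c).pos i = (round L stage1Rule c).pos j := by
  obtain ⟨x, hx, hxi⟩ := exists_leads (stage1_unsettled_of hP hi)
  by_cases hf : c.pos x ∈ c.hosts
  · obtain ⟨r, hr, hrx⟩ := mem_hosts.1 hf
    rw [(stage1_host hP hx (stage1_unsettled_of hP hi) hxi.symm hr hrx).2.1,
      (stage1_host hP hx (stage1_unsettled_of hP hj) (hij.symm.trans hxi.symm) hr hrx).2.1]
    exact fst_move_congr _ _ _ _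
  · rcases stage1_free (L := L) hx (stage1_unsettled_of hP hi) hxi.symm hf with h | h
    · rw [hi] at h
      exact absurd h.2.2.1 (by simp)
    · rcases stage1_free (L := L) hx (stage1_unsettled_of hP hj) (hij.symm.trans hxi.symm) hf with h' | h'
      · rw [hj] at h'
        exact absurd h'.2.2.1 (by simp)
      · rw [h.2.2.1, h'.2.2.1]
        exact fst_move_congr _ _ _ _

/-- A robot that settles does so at a free node, where it has the highest ID. -/
theorem stage1_settles (hP : c.Proper) (hi : (c.mem i).settled = false)
    (hi' : ((round L stage1Rule c).mem i).settled = true) :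
    (round L stage1Rule c).pos i = c.pos i ∧ c.pos i ∉ c.hosts ∧
    (∀ y, c.pos y = c.pos i → (c.mem y).settled = false → y ≤ i) ∧
    ∃ x, c.Leads x ∧ c.pos x = c.pos i ∧ ((round L stage1Rule c).mem i).treelabel = x := by
  obtain ⟨x, hx, hxi⟩ := exists_leads hi
  by_cases hf : c.pos x ∈ c.hosts
  · obtain ⟨r, hr, hrx⟩ := mem_hosts.1 hf
    have := (stage1_host (L := L) hP hx hi hxi.symm hr hrx).1
    rw [hi'] at this
    cases this
  · rcases stage1_free (L := L) hx hi hxi.symm hf with h | h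
    · exact ⟨h.2.1, hxi ▸ hf, fun y hy => h.1 y (hy.trans hxi.symm), x, hx, hxi, h.2.2.2.1⟩
    · rw [hi'] at h
      exact absurd h.2.1 (by simp)

theorem stage1_proper (hP : c.Proper) : (round L stage1Rule c).Proper := by
  intro i j hi hj hij
  by_cases h1 : (c.mem i).settled = true <;> by_cases h2 : (c.mem j).settled = true
  · rw [(stage1_settled hP h1).1, (stage1_settled hP h2).1] at hij
    exact hP i j h1 h2 hij
  · obtain ⟨h3, h4, -⟩ := stage1_settles hP (by simpa using h2) hj
    rw [(stage1_settled hP h1).1, h3] at hij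
    exact absurd (mem_hosts.2 ⟨i, h1, hij⟩) h4
  · obtain ⟨h3, h4, -⟩ := stage1_settles hP (by simpa using h1) hi
    rw [(stage1_settled hP h2).1, h3] at hij
    exact absurd (mem_hosts.2 ⟨j, h2, hij.symm⟩) h4
  · obtain ⟨h3, -, h4, -⟩ := stage1_settles hP (by simpa using h1) hi
    obtain ⟨h5, -, h6, -⟩ := stage1_settles hP (by simpa using h2) hj
    rw [h3, h5] at hij
    exact le_antisymm (h6 i hij (by simpa using h1)) (h4 j hij.symm (by simpa using h2))

theorem stage1_hosts_subset (hP : c.Proper) : c.hosts ⊆ (round L stage1Rule c).hosts := by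
  intro v hv
  obtain ⟨r, hr, rfl⟩ := mem_hosts.1 hv
  have := stage1_settled (L := L) hP hr
  exact mem_hosts.2 ⟨r, this.2.1, this.1⟩

/-- After a round every node that was visited holds a settled robot. -/
theorem stage1_mem_hosts (hP : c.Proper) (hi : (c.mem i).settled = false) :
    c.pos i ∈ (round L stage1Rule c).hosts := by
  by_cases hf : c.pos i ∈ c.hosts
  · exact stage1_hosts_subset hP hf
  · obtain ⟨x, hx, hxi⟩ := exists_leads hi
    obtain ⟨y, hy, hmax⟩ := Finset.exists_max_image
      (Finset.univ.filter fun y => c.pos y = c.pos x ∧ (c.mem y).settled = false) id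
      ⟨x, by simp [hx.1]⟩
    simp only [Finset.mem_filter, Finset.mem_univ, true_and, id] at hy hmax
    rcases stage1_free (L := L) hx hy.2 hy.1 (hxi ▸ hf) with h | ⟨⟨z, h1, h2, h3⟩, -⟩
    · exact mem_hosts.2 ⟨y, h.2.2.1, h.2.1.trans (hy.1.trans hxi)⟩
    · exact absurd (hmax z ⟨h1, h2⟩) (not_le.2 h3)

/-- Leaders after a round have been leaders before. -/
theorem stage1_leads_of (hP : c.Proper) (hx : (round L stage1Rule c).Leads x) : c.Leads x := by
  have hx0 := stage1_unsettled_of hP hx.1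
  refine ⟨hx0, fun y hy hy' => ?_⟩
  by_cases h : ((round L stage1Rule c).mem y).settled = true
  · exact (stage1_settles hP hy' h).2.2.1 x hy.symm hx0
  · have h : ((round L stage1Rule c).mem y).settled = false := by simpa using h
    exact hx.2 y (stage1_together hP hy h hx.1) h

theorem stage1_move (hP : c.Proper) (hi : ((round L stage1Rule c).mem i).settled = false) :
    (round L stage1Rule c).pos i = c.pos i ∨ G.Adj (c.pos i) ((round L stage1Rule c).pos i) := by
  have key : ∀ v e p, (L.move v e p).1 = v ∨ G.Adj v (L.move v e p).1 := by
    intro v e p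
    rcases move_cases L v e p with h | h
    · exact Or.inl (by rw [h])
    · exact Or.inr (exit_adj h)
  have hi0 := stage1_unsettled_of hP hi
  obtain ⟨x, hx, hxi⟩ := exists_leads hi0
  by_cases hf : c.pos x ∈ c.hosts
  · obtain ⟨r, hr, hrx⟩ := mem_hosts.1 hf
    rw [(stage1_host hP hx hi0 hxi.symm hr hrx).2.1, ← hxi]
    exact key _ _ _
  · rcases stage1_free (L := L) hx hi0 hxi.symm hf with h | h
    · rw [hi] at h
      exact absurd h.2.2.1 (by simp)
    · rw [h.2.2.1, ← hxi]
      exact key _ _ _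

/-- The configuration agrees with the state `s` of the solitary search of `x`, except that other
searches may have overwritten visited nodes with labels below `x`. -/
structure Sim1 (x : Fin k) (c : Config V k) (s : Search V) : Prop where
  pos : c.pos x = s.head
  ent : (c.mem x).entered = s.ent
  vis : ∀ v ∈ s.vis, ∃ r, (c.mem r).settled = true ∧ c.pos r = v ∧ (c.mem r).treelabel ≤ x ∧
    ((c.mem r).treelabel = x → (c.mem r).parent = s.par v ∧ (c.mem r).child = s.ch v)
  unvis : ∀ r, (c.mem r).settled = true → c.pos r ∉ s.vis → (c.mem r).treelabel ≠ x

theorem Sim1.vis_subset {s : Search V} (h : Sim1 x c s) : s.vis ⊆ c.hosts := by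
  intro v hv
  obtain ⟨r, h1, h2, -⟩ := h.vis v hv
  exact mem_hosts.2 ⟨r, h1, h2⟩

/-- The part of the simulation that does not concern the node of `x`. -/
theorem Sim1.step_away {s : Search V} (hP : c.Proper) (hx : c.Leads x) (h : Sim1 x c s) :
    (∀ v ∈ s.vis, v ≠ s.head → ∃ r, ((round L stage1Rule c).mem r).settled = true ∧
      (round L stage1Rule c).pos r = v ∧ ((round L stage1Rule c).mem r).treelabel ≤ x ∧
      (((round L stage1Rule c).mem r).treelabel = x →
        ((round L stage1Rule c).mem r).parent = s.par v ∧
        ((round L stage1Rule c).mem r).child = s.ch v)) ∧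
    (∀ r, ((round L stage1Rule c).mem r).settled = true → (round L stage1Rule c).pos r ∉ s.vis →
      (round L stage1Rule c).pos r ≠ s.head →
      ((round L stage1Rule c).mem r).treelabel ≠ x) := by
  constructor
  · intro v hv hvh
    obtain ⟨r, h1, h2, h3, h4⟩ := h.vis v hv
    obtain ⟨h5, h6, h7⟩ := stage1_settled (L := L) hP h1
    refine ⟨r, h6, h5.trans h2, ?_⟩
    rcases h7 with ⟨h7, -⟩ | ⟨y, hy, hyr, h8, h9⟩
    · rw [h7]
      exact ⟨h3, h4⟩
    · have hyx : y ≠ x := by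
        rintro rfl
        exact hvh (h2.symm.trans (hyr.symm.trans h.pos))
      have hyx' : (y : WithTop (Fin k)) ≠ x := by simpa using hyx
      rw [h8]
      rcases h9 with ⟨h9, -⟩ | ⟨h9, -⟩
      · exact ⟨h9 ▸ h3, fun h => absurd h hyx'⟩
      · exact ⟨h9.le.trans h3, fun h => absurd h hyx'⟩
  · intro r hr hrv hrh
    by_cases h1 : (c.mem r).settled = true
    · obtain ⟨h5, h6, h7⟩ := stage1_settled (L := L) hP h1
      rw [h5] at hrv hrh
      rcases h7 with ⟨h7, -⟩ | ⟨y, hy, hyr, h8, -⟩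
      · rw [h7]
        exact h.unvis r h1 hrv
      · rw [h8]
        have hyx : y ≠ x := by
          rintro rfl
          exact hrh (hyr.symm.trans h.pos)
        simpa using hyx
    · obtain ⟨h5, -, -, y, hy, hyr, h8⟩ := stage1_settles hP (by simpa using h1) hr
      rw [h5] at hrh
      rw [h8]
      have hyx : y ≠ x := by
        rintro rfl
        exact hrh (hyr.symm.trans h.pos)
      simpa using hyx

theorem Sim1.step {s : Search V} {root : V} {t : ℕ} (hP : c.Proper) (hx : c.Leads x)
    (hx' : ((round L stage1Rule c).mem x).settled = false)
    (hlab : ∀ r, (c.mem r).settled = true → c.pos r = c.pos x → ¬ (c.mem r).treelabel < x)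
    (h : Sim1 x c s) (hI : s.Inv L Finset.univ root) (ht : s.Timed L Finset.univ root t)
    (hC : ¬ s.Complete root G) :
    Sim1 x (round L stage1Rule c) (s.step L Finset.univ root) := by
  obtain ⟨haw1, haw2⟩ := h.step_away (L := L) hP hx
  rw [Search.step, if_pos (Finset.mem_univ _)]
  by_cases hv : s.head ∈ s.vis
  · rw [if_pos hv]
    obtain ⟨r, h1, h2, h3, h4⟩ := h.vis _ hv
    have hrx : c.pos r = c.pos x := h2.trans h.pos.symm
    have hl : (c.mem r).treelabel = x := h3.eq_of_not_lt (hlab r h1 hrx)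
    obtain ⟨h5, h6⟩ := h4 hl
    obtain ⟨h7, h8, h9⟩ := stage1_settled (L := L) hP h1
    obtain ⟨-, h10, h11⟩ := stage1_host (L := L) hP hx hx.1 rfl h1 hrx
    rw [hostPort, if_neg (hlab r h1 hrx), if_pos hl, h.pos, h.ent] at h10 h11
    rw [Search.continue_eq hI ht hC hv (c.mem r) h5 h6]
    refine ⟨h10, h11, ?_, ?_⟩
    · intro v hvv
      by_cases hvh : v = s.head
      · subst hvh
        refine ⟨r, h8, h7.trans h2, ?_⟩
        rcases h9 with ⟨-, h9⟩ | ⟨y, hy, hyr, h12, h13⟩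
        · exact absurd (h9 x hx hrx.symm) (hlab r h1 hrx)
        · obtain rfl := hy.unique hx (hyr.trans hrx)
          refine ⟨h12.le, fun _ => ?_⟩
          rcases h13 with ⟨-, h14, h15⟩ | ⟨h14, -⟩
          · rw [h14, h15, h5, h2, h.ent]
            simp
          · exact absurd hl h14.ne'
      · obtain ⟨r', h12, h13, h14, h15⟩ := haw1 v hvv hvh
        refine ⟨r', h12, h13, h14, ?_⟩
        simpa [Function.update_of_ne hvh] using h15
    · intro r' h12 h13
      exact haw2 r' h12 h13 fun h14 => h13 (h14 ▸ hv)
  · rw [if_neg hv]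
    -- The node of `x` is free or has a label above `x`, so the settled robot is adopted.
    have key : (∃ r, ((round L stage1Rule c).mem r).settled = true ∧
          (round L stage1Rule c).pos r = s.head ∧
          ((round L stage1Rule c).mem r).treelabel = x ∧
          ((round L stage1Rule c).mem r).parent = s.ent ∧
          ((round L stage1Rule c).mem r).child = nextPort (G.degree s.head) s.ent 0) ∧
        (round L stage1Rule c).pos x = (L.move s.head s.ent (exitPort (G.degree s.head) s.ent
          (nextPort (G.degree s.head) s.ent 0))).1 ∧
        ((round L stage1Rule c).mem x).entered = (L.move s.head s.ent
          (exitPort (G.degree s.head) s.ent (nextPort (G.degree s.head) s.ent 0))).2 := by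
      by_cases hf : c.pos x ∈ c.hosts
      · obtain ⟨r, hr, hrx⟩ := mem_hosts.1 hf
        have hne : (c.mem r).treelabel ≠ x := h.unvis r hr (by rwa [hrx, h.pos])
        obtain ⟨-, h10, h11⟩ := stage1_host (L := L) hP hx hx.1 rfl hr hrx
        rw [hostPort, if_neg (hlab r hr hrx), if_neg hne, h.pos, h.ent] at h10 h11
        refine ⟨⟨r, ?_⟩, h10, h11⟩
        obtain ⟨h7, h8, h9⟩ := stage1_settled (L := L) hP hr
        refine ⟨h8, h7.trans (hrx.trans h.pos), ?_⟩
        rcases h9 with ⟨-, h9⟩ | ⟨y, hy, hyr, h12, h13⟩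
        · exact absurd (h9 x hx hrx.symm) (hlab r hr hrx)
        · obtain rfl := hy.unique hx (hyr.trans hrx)
          rcases h13 with ⟨h14, -⟩ | ⟨-, h14, h15⟩
          · exact absurd h14 hne
          · rw [h12, h14, h15, h.ent, hrx, h.pos]
            simp
      · obtain ⟨y, hy, hmax⟩ := Finset.exists_max_image
          (Finset.univ.filter fun y => c.pos y = c.pos x ∧ (c.mem y).settled = false) id
          ⟨x, by simp [hx.1]⟩
        simp only [Finset.mem_filter, Finset.mem_univ, true_and, id] at hy hmax
        refine ⟨⟨y, ?_⟩, ?_⟩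
        · rcases stage1_free (L := L) hx hy.2 hy.1 hf with h7 | ⟨⟨z, h7, h8, h9⟩, -⟩
          · obtain ⟨-, h8, h9, h10, h11, h12⟩ := h7
            refine ⟨h9, h8.trans (hy.1.trans h.pos), h10, h11.trans h.ent, ?_⟩
            rw [h12, hy.1, h.pos, h.ent]
          · exact absurd (hmax z ⟨h7, h8⟩) (not_le.2 h9)
        · rcases stage1_free (L := L) hx hx.1 rfl hf with h7 | ⟨-, -, h8, h9⟩
          · rw [hx'] at h7
            exact absurd h7.2.2.1 (by simp)
          · rw [h8, h9, h.pos, h.ent]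
            exact ⟨rfl, rfl⟩
    obtain ⟨⟨r, h1, h2, h3, h4, h5⟩, h6, h7⟩ := key
    refine ⟨h6, h7, ?_, ?_⟩
    · intro v hvv
      by_cases hvh : v = s.head
      · subst hvh
        refine ⟨r, h1, h2, h3.le, fun _ => ?_⟩
        simp [Search.adopt, h4, h5]
      · obtain ⟨r', h12, h13, h14, h15⟩ := haw1 v ((Finset.mem_insert.1 hvv).resolve_left hvh) hvh
        refine ⟨r', h12, h13, h14, ?_⟩
        simpa [Search.adopt, Function.update_of_ne hvh] using h15
    · intro r' h12 h13
      simp only [Search.adopt, Finset.mem_insert, not_or] at h13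
      exact haw2 r' h12 h13.2 h13.1

end Stage1

/-! ### The end of Stage 1 -/

section Stage1

variable {V : Type*} [Fintype V] [DecidableEq V] {G : SimpleGraph V} [DecidableRel G.Adj]
  {L : PortLabelling G} {k : ℕ} {c c₀ : Config V k} {x i r : Fin k}

/-- The configurations in which a pass begins. -/
structure Config.Blank (c : Config V k) : Prop where
  proper : c.Proper
  treelabel : ∀ i, (c.mem i).treelabel = ⊤
  entered : ∀ i, (c.mem i).entered = 0

theorem iterate_round_succ (rule : LocalRule k) (t : ℕ) :
    (round L rule)^[t + 1] c = round L rule ((round L rule)^[t] c) :=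
  Function.iterate_succ_apply' _ _ _

theorem stage1_iterate_proper (hP : c.Proper) (t : ℕ) : ((round L stage1Rule)^[t] c).Proper := by
  induction t with
  | zero => exact hP
  | succ t ih => rw [iterate_round_succ]; exact stage1_proper ih

theorem stage1_iterate_leads_of (hP : c.Proper) {t : ℕ} (d : ℕ)
    (hx : ((round L stage1Rule)^[t + d] c).Leads x) : ((round L stage1Rule)^[t] c).Leads x := by
  induction d with
  | zero => exact hx
  | succ d ih =>
    rw [← add_assoc, iterate_round_succ] at hx
    exact ih (stage1_leads_of (stage1_iterate_proper hP _) hx)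

/-- At the node of `x` there is a settled robot that belongs to the search of a lower ID. -/
def Config.Halted (c : Config V k) (x : Fin k) : Prop :=
  ∃ r, (c.mem r).settled = true ∧ c.pos r = c.pos x ∧ (c.mem r).treelabel < x

theorem Config.Halted.round (hP : c.Proper) (hx : c.Leads x) (h : c.Halted x) :
    (round L stage1Rule c).Halted x := by
  obtain ⟨r, hr, hrx, hl⟩ := h
  obtain ⟨h1, h2, h3⟩ := stage1_settled (L := L) hP hr
  obtain ⟨-, h4, -⟩ := stage1_host (L := L) hP hx hx.1 rfl hr hrx
  rw [hostPort, if_pos hl, move_zero] at h4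
  refine ⟨r, h2, h1.trans (hrx.trans h4.symm), ?_⟩
  rcases h3 with ⟨h3, -⟩ | ⟨y, hy, hyr, h5, h6⟩
  · rwa [h3]
  · obtain rfl := hy.unique hx (hyr.trans hrx)
    rcases h6 with ⟨h6, -⟩ | ⟨h6, -⟩
    · exact absurd h6 hl.ne
    · exact absurd h6 hl.not_gt

/-- A leader that is unsettled at the end of Stage 1 has been halted: otherwise its search would have
visited, and filled with settled robots, all nodes of the graph. -/
theorem stage1_halted (hG : G.Connected) (hd : ∀ v, 0 < G.degree v) (hk : k ≤ Fintype.card V)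
    (hB : c.Blank) (hx : (stage1 L c).Leads x) : (stage1 L c).Halted x := by
  have hP := stage1_iterate_proper (L := L) hB.proper
  have hlead : ∀ t ≤ stageBound G k + 1, ((round L stage1Rule)^[t] c).Leads x := by
    intro t ht
    obtain ⟨d, hd⟩ := Nat.exists_eq_add_of_le ht
    refine stage1_iterate_leads_of hB.proper d ?_
    rw [← hd]
    exact hx
  suffices h : ∃ t ≤ stageBound G k + 1, ((round L stage1Rule)^[t] c).Halted x by
    obtain ⟨t, ht, h⟩ := h
    obtain ⟨d, hd⟩ := Nat.exists_eq_add_of_le ht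
    have key : ∀ e, t + e ≤ stageBound G k + 1 →
        ((round L stage1Rule)^[t + e] c).Halted x := by
      intro e
      induction e with
      | zero => exact fun _ => h
      | succ e ih =>
        intro he
        rw [← add_assoc, iterate_round_succ]
        exact (ih (by omega)).round (hP _) (hlead _ (by omega))
    have := key d (by omega)
    rw [← hd] at this
    exact this
  by_contra! hcon
  have hinv := search_inv (L := L) (Finset.mem_univ (c.pos x)) (hd (c.pos x))
  have hnc : ∀ t ≤ stageBound G k + 1,
      Sim1 x ((round L stage1Rule)^[t] c) (search L Finset.univ (c.pos x) t) →
      ¬ (search L Finset.univ (c.pos x) t).Complete (c.pos x) G := by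
    intro t ht hs hC
    have hlt := card_hosts_lt (hlead t ht).1
    have huniv : ∀ v, v ∈ (search L Finset.univ (c.pos x) t).vis := by
      intro v
      refine hC.mem_vis_of_linked (hinv t).1 ⟨Finset.mem_univ _, ?_⟩
      refine Relation.ReflTransGen.mono (fun _ _ h => ⟨Finset.mem_univ _, Finset.mem_univ _, h⟩) _ _
        ((SimpleGraph.reachable_iff_reflTransGen _ _).1 (hG.preconnected (c.pos x) v))
    have : Fintype.card V ≤ ((round L stage1Rule)^[t] c).hosts.card := by
      rw [← Finset.card_univ]
      exact Finset.card_le_card fun v _ => hs.vis_subset (huniv v)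
    omega
  have hsim : ∀ t ≤ stageBound G k + 1,
      Sim1 x ((round L stage1Rule)^[t] c) (search L Finset.univ (c.pos x) t) := by
    intro t
    induction t with
    | zero =>
      intro _
      refine ⟨rfl, hB.entered x, ?_, ?_⟩
      · intro v hv
        simp [search, Search.init] at hv
      · intro r _ _
        simp [hB.treelabel r]
    | succ t ih =>
      intro ht
      have hs := ih (by omega)
      rw [search_succ, iterate_round_succ]
      have h1 := hlead (t + 1) ht
      rw [iterate_round_succ] at h1
      refine hs.step (hP t) (hlead t (by omega)) h1.1 ?_ (hinv t).1 (hinv t).2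
        (hnc t (by omega) hs)
      intro r h2 h3 h4
      exact hcon t (by omega) ⟨r, h2, h3, h4⟩
  have hs := hsim _ le_rfl
  exact hnc _ le_rfl hs (search_complete (Finset.mem_univ _) hd
    ((Finset.card_le_card hs.vis_subset).trans card_hosts_le))

/-- Each label is the ID of a robot that led at the start, and its node is linked to the node where
that robot started; so is the node of each leader. -/
structure Traced (G : SimpleGraph V) (c₀ c : Config V k) : Prop where
  label : ∀ r, (c.mem r).settled = true → (c.mem r).treelabel = ⊤ ∨
    ∃ y : Fin k, (c.mem r).treelabel = y ∧ c₀.Leads y ∧ Linked G c.hosts (c₀.pos y) (c.pos r)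
  leader : ∀ x, c.Leads x → c₀.Leads x ∧
    ∀ S : Finset V, c.hosts ⊆ S → c.pos x ∈ S → Linked G S (c₀.pos x) (c.pos x)

theorem Traced.round (hP : c.Proper) (h : Traced G c₀ c) :
    Traced G c₀ (round L stage1Rule c) := by
  have hsub := stage1_hosts_subset (L := L) hP
  have hlink : ∀ x, c.Leads x →
      Linked G (Dispersion.round L stage1Rule c).hosts (c₀.pos x) (c.pos x) := fun x hx =>
    (h.leader x hx).2 _ hsub (stage1_mem_hosts hP hx.1)
  constructor
  · intro r hr
    by_cases h1 : (c.mem r).settled = true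
    · obtain ⟨h2, -, h3⟩ := stage1_settled (L := L) hP h1
      rw [h2]
      rcases h3 with ⟨h3, -⟩ | ⟨y, hy, hyr, h5, -⟩
      · rw [h3]
        rcases h.label r h1 with h4 | ⟨y, h4, h5, h6⟩
        · exact Or.inl h4
        · exact Or.inr ⟨y, h4, h5, h6.mono hsub⟩
      · exact Or.inr ⟨y, h5, (h.leader y hy).1, hyr ▸ hlink y hy⟩
    · obtain ⟨h2, -, -, y, hy, hyr, h3⟩ := stage1_settles hP (by simpa using h1) hr
      rw [h2]
      exact Or.inr ⟨y, h3, (h.leader y hy).1, hyr ▸ hlink y hy⟩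
  · intro x hx
    have hx0 := stage1_leads_of hP hx
    refine ⟨(h.leader x hx0).1, fun S hS hxS => ?_⟩
    have h1 := (hlink x hx0).mono hS
    rcases stage1_move hP hx.1 with h2 | h2
    · rwa [h2]
    · exact h1.tail h2 hxS

theorem traced_iterate (hB : c.Blank) (t : ℕ) :
    Traced G c ((round L stage1Rule)^[t] c) := by
  induction t with
  | zero =>
    exact ⟨fun r _ => Or.inl (hB.treelabel r), fun x hx => ⟨hx, fun S _ h => Linked.refl h⟩⟩
  | succ t ih =>
    rw [iterate_round_succ]
    exact ih.round (stage1_iterate_proper hB.proper t)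

theorem stage1_end_proper (hB : c.Blank) : (stage1 L c).Proper :=
  stage1_iterate_proper hB.proper _

/-- At the end of Stage 1, a node with unsettled robots holds a settled robot, and it is linked to the
nodes where two different groups have started. -/
theorem stage1_end (hG : G.Connected) (hd : ∀ v, 0 < G.degree v) (hk : k ≤ Fintype.card V)
    (hB : c.Blank) (hi : ((stage1 L c).mem i).settled = false) :
    (stage1 L c).pos i ∈ (stage1 L c).hosts ∧
    ∃ x y, c.Leads x ∧ c.Leads y ∧ c.pos x ≠ c.pos y ∧
      Linked G (stage1 L c).hosts ((stage1 L c).pos i) (c.pos x) ∧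
      Linked G (stage1 L c).hosts ((stage1 L c).pos i) (c.pos y) := by
  obtain ⟨x, hx, hxi⟩ := exists_leads hi
  obtain ⟨r, hr, hrx, hl⟩ := stage1_halted hG hd hk hB hx
  have hT : Traced G c (stage1 L c) := traced_iterate hB _
  have hmem : (stage1 L c).pos x ∈ (stage1 L c).hosts := mem_hosts.2 ⟨r, hr, hrx⟩
  refine ⟨hxi ▸ hmem, ?_⟩
  rcases hT.label r hr with h | ⟨y, h1, h2, h3⟩
  · rw [h] at hl
    exact absurd hl not_top_lt
  · obtain ⟨h4, h5⟩ := hT.leader x hx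
    refine ⟨x, y, h4, h2, fun h => ?_, ?_, ?_⟩
    · rw [h4.unique h2 h, h1] at hl
      exact lt_irrefl _ hl
    · rw [← hxi]
      exact (h5 _ subset_rfl hmem).symm
    · rw [← hxi, ← hrx]
      exact h3.symm

end Stage1

/-! ### One round of Stage 2 -/

section Stage2

variable {V : Type*} [Fintype V] [DecidableEq V] {G : SimpleGraph V} [DecidableRel G.Adj]
  {L : PortLabelling G} {k : ℕ} {c : Config V k} {x i r : Fin k}

theorem priority_le_iff {m m' : ℕ} {a b : WithTop (Fin k)} :
    priority m a ≤ priority m' b ↔ m < m' ∨ m = m' ∧ b ≤ a := by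
  simp [priority, Prod.Lex.toLex_le_toLex]

theorem priority_lt_iff {m m' : ℕ} {a b : WithTop (Fin k)} :
    priority m a < priority m' b ↔ m < m' ∨ m = m' ∧ b < a := by
  simp [priority, Prod.Lex.toLex_lt_toLex]

theorem priority_inj {m m' : ℕ} {a b : WithTop (Fin k)} :
    priority m a = priority m' b ↔ m = m' ∧ a = b := by
  simp [priority]

/-- The priority of the unsettled robot `i`. -/
def Config.prio (c : Config V k) (i : Fin k) : ℕ ×ₗ (WithTop (Fin k))ᵒᵈ :=
  priority (c.mem i).mult i

/-- The priority of the settled robot `r`. -/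
def Config.hostPrio (c : Config V k) (r : Fin k) : ℕ ×ₗ (WithTop (Fin k))ᵒᵈ :=
  priority (c.mem r).mult (c.mem r).treelabel

theorem prio_injective : Function.Injective c.prio := by
  intro i j h
  simpa using (priority_inj.1 h).2

/-- `x` has the highest priority among the unsettled robots of its node. -/
def Config.Tops (c : Config V k) (x : Fin k) : Prop :=
  (c.mem x).settled = false ∧
    ∀ y, c.pos y = c.pos x → (c.mem y).settled = false → c.prio y ≤ c.prio x

theorem exists_tops (hi : (c.mem i).settled = false) : ∃ x, c.Tops x ∧ c.pos x = c.pos i := by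
  obtain ⟨x, hx, hmax⟩ := Finset.exists_max_image
    (Finset.univ.filter fun y => c.pos y = c.pos i ∧ (c.mem y).settled = false) c.prio
    ⟨i, by simp [hi]⟩
  simp only [Finset.mem_filter, Finset.mem_univ, true_and] at hx hmax
  exact ⟨x, ⟨hx.2, fun y h1 h2 => hmax y ⟨h1.trans hx.1, h2⟩⟩, hx.1⟩

theorem Config.Tops.unique {y : Fin k} (hx : c.Tops x) (hy : c.Tops y) (h : c.pos x = c.pos y) :
    x = y :=
  prio_injective (le_antisymm (hy.2 x h hx.1) (hx.2 y h.symm hy.1))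

theorem Config.Tops.highestPriority (hx : c.Tops x) {v : V} (hv : c.pos x = v) :
    highestPriority c.mem (unsettledOf (c.at v) c.mem) = some x := by
  subst hv
  unfold Dispersion.highestPriority
  rw [lowestID_eq_some]
  simp only [Finset.mem_filter, mem_unsettledOf]
  refine ⟨⟨⟨hx.1, trivial⟩, fun y hy => ?_⟩, fun y hy => ?_⟩
  · rcases priority_le_iff.1 (hx.2 y hy.2 hy.1) with h | h
    · exact h.le
    · exact h.1.le
  · rcases priority_le_iff.1 (hx.2 y hy.1.2 hy.1.1) with h | h
    · exact absurd (hy.2 x ⟨hx.1, rfl⟩) (not_le.2 h)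
    · simpa using h.2

theorem stage2Rule_none (h : ∀ y, c.pos y = c.pos i → (c.mem y).settled = true) (δ : ℕ) :
    stage2Rule δ (c.at (c.pos i)) c.mem i = (c.mem i, 0) := by
  have : unsettledOf (c.at (c.pos i)) c.mem = ∅ := by
    rw [Finset.eq_empty_iff_forall_notMem]
    intro y hy
    obtain ⟨h1, h2⟩ := mem_unsettledOf.1 hy
    simp [h y h2] at h1
  have : highestPriority c.mem (unsettledOf (c.at (c.pos i)) c.mem) = none := by
    rw [this]
    exact lowestID_eq_none.2 (by simp)
  simp [stage2Rule, this, stay]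

theorem stage2Rule_free (hi : (c.mem i).settled = false) (hf : c.pos i ∉ c.hosts) (δ : ℕ) :
    stage2Rule δ (c.at (c.pos i)) c.mem i = (c.mem i, (c.mem i).entered) := by
  obtain ⟨x, hx, hxi⟩ := exists_tops hi
  simp only [stage2Rule, hx.highestPriority hxi, lowestID_settledOf_free hf]

theorem stage2Rule_host (hP : c.Proper) (hx : c.Tops x) (hi : c.pos i = c.pos x)
    (hr : (c.mem r).settled = true) (hrx : c.pos r = c.pos x) (δ : ℕ) :
    stage2Rule δ (c.at (c.pos i)) c.mem i =
      if c.prio x < c.hostPrio r then (c.mem i, 0)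
      else if c.prio x = c.hostPrio r then
        if i = r then ({ c.mem r with child := advance δ (c.mem r) (c.mem x).entered }, 0)
        else if (c.mem x).home = r then
          if i = x ∧ advance δ (c.mem r) (c.mem x).entered ≤ δ then
            (c.mem x, continuePort δ (c.mem r) (c.mem x).entered) else (c.mem i, 0)
        else (c.mem i, continuePort δ (c.mem r) (c.mem x).entered)
      else
        if i = r then
          ({ c.mem r with
              treelabel := x
              mult := (c.mem x).mult
              parent := (c.mem x).entered
              child := nextPort δ (c.mem x).entered 0 }, 0)
        else (c.mem i, exitPort δ (c.mem x).entered (nextPort δ (c.mem x).entered 0)) := by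
  rw [hi]
  simp only [stage2Rule, hx.highestPriority rfl, lowestID_settledOf hP hr hrx, stay, Config.prio,
    Config.hostPrio]

/-- What a round of Stage 2 does to a settled robot. -/
theorem stage2_settled (hP : c.Proper) (hr : (c.mem r).settled = true) :
    (round L stage2Rule c).pos r = c.pos r ∧
    ((round L stage2Rule c).mem r).settled = true ∧
    (((round L stage2Rule c).mem r = c.mem r ∧
        ∀ x, c.Tops x → c.pos x = c.pos r → c.prio x < c.hostPrio r) ∨
      ∃ x, c.Tops x ∧ c.pos x = c.pos r ∧ ((round L stage2Rule c).mem r).treelabel = x ∧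
        ((round L stage2Rule c).mem r).mult = (c.mem x).mult ∧
        ((c.prio x = c.hostPrio r ∧
          ((round L stage2Rule c).mem r).parent = (c.mem r).parent ∧
          ((round L stage2Rule c).mem r).child =
            advance (G.degree (c.pos r)) (c.mem r) (c.mem x).entered) ∨
        (c.hostPrio r < c.prio x ∧
          ((round L stage2Rule c).mem r).parent = (c.mem x).entered ∧
          ((round L stage2Rule c).mem r).child =
            nextPort (G.degree (c.pos r)) (c.mem x).entered 0))) := by
  by_cases hu : ∃ y, c.pos y = c.pos r ∧ (c.mem y).settled = false
  · obtain ⟨y, hy, hy'⟩ := hu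
    obtain ⟨x, hx, hxy⟩ := exists_tops hy'
    have hxr : c.pos r = c.pos x := (hxy.trans hy).symm
    have h := stage2Rule_host hP hx hxr hr hxr (G.degree (c.pos r))
    rw [if_pos rfl, if_pos rfl] at h
    rcases lt_trichotomy (c.prio x) (c.hostPrio r) with h1 | h1 | h1
    · rw [if_pos h1] at h
      rw [round_pos _ _ h, round_mem _ _ h, move_zero]
      refine ⟨rfl, hr, Or.inl ⟨rfl, fun x' hx' h' => ?_⟩⟩
      rwa [hx'.unique hx (h'.trans hxr)]
    · rw [if_neg h1.not_lt, if_pos h1] at h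
      rw [round_pos _ _ h, round_mem _ _ h, move_zero]
      obtain ⟨h2, h3⟩ := priority_inj.1 h1
      exact ⟨rfl, hr, Or.inr ⟨x, hx, hxr.symm, h3.symm, h2.symm, Or.inl ⟨h1, rfl, rfl⟩⟩⟩
    · rw [if_neg h1.not_gt, if_neg h1.ne'] at h
      rw [round_pos _ _ h, round_mem _ _ h, move_zero]
      exact ⟨rfl, hr, Or.inr ⟨x, hx, hxr.symm, rfl, rfl, Or.inr ⟨h1, rfl, rfl⟩⟩⟩
  · push Not at hu
    have h := stage2Rule_none (i := r) (fun y hy => by simpa using hu y hy) (G.degree (c.pos r))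
    rw [round_pos _ _ h, round_mem _ _ h, move_zero]
    refine ⟨rfl, hr, Or.inl ⟨rfl, fun x hx h' => ?_⟩⟩
    exact absurd hx.1 (hu x h')

/-- The robot `i` leaves its node by port `p`, or stays if there is no such port, and its memory is
not altered otherwise. -/
structure Moves (L : PortLabelling G) (c c' : Config V k) (i : Fin k) (p : ℕ) : Prop where
  pos : c'.pos i = (L.move (c.pos i) (c.mem i).entered p).1
  mem : c'.mem i = { c.mem i with entered := (L.move (c.pos i) (c.mem i).entered p).2 }

theorem moves_of_rule {rule : LocalRule k} {p : ℕ}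
    (h : rule (G.degree (c.pos i)) (c.at (c.pos i)) c.mem i = (c.mem i, p)) :
    Moves L c (round L rule c) i p :=
  ⟨round_pos _ _ h, round_mem _ _ h⟩

theorem stage2_free (hi : (c.mem i).settled = false) (hf : c.pos i ∉ c.hosts) :
    Moves L c (round L stage2Rule c) i (c.mem i).entered :=
  moves_of_rule (stage2Rule_free hi hf _)

/-- The port by which the visitor `i` leaves a node whose settled robot is `r`, if `x` is the visitor
of highest priority. -/
def Config.hostPort2 (c : Config V k) (δ : ℕ) (r x i : Fin k) : ℕ :=
  if c.prio x < c.hostPrio r then 0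
  else if c.prio x = c.hostPrio r then
    if (c.mem x).home = r then
      if i = x ∧ advance δ (c.mem r) (c.mem x).entered ≤ δ then
        continuePort δ (c.mem r) (c.mem x).entered else 0
    else continuePort δ (c.mem r) (c.mem x).entered
  else exitPort δ (c.mem x).entered (nextPort δ (c.mem x).entered 0)

theorem stage2_host (hP : c.Proper) (hx : c.Tops x) (hi : (c.mem i).settled = false)
    (hix : c.pos i = c.pos x) (hr : (c.mem r).settled = true) (hrx : c.pos r = c.pos x) :
    Moves L c (round L stage2Rule c) i (c.hostPort2 (G.degree (c.pos x)) r x i) := by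
  have hir : i ≠ r := by
    rintro rfl
    simp [hi] at hr
  apply moves_of_rule
  rw [stage2Rule_host hP hx hix hr hrx, Config.hostPort2, if_neg hir, if_neg hir, hix]
  split_ifs with h1 h2 h3 h4
  · rfl
  · rw [h4.1]
  all_goals rfl

theorem stage2_moves (hP : c.Proper) (hi : (c.mem i).settled = false) :
    ∃ p, Moves L c (round L stage2Rule c) i p := by
  by_cases hf : c.pos i ∈ c.hosts
  · obtain ⟨r, hr, hri⟩ := mem_hosts.1 hf
    obtain ⟨x, hx, hxi⟩ := exists_tops hi
    exact ⟨_, stage2_host hP hx hi hxi.symm hr (hri.trans hxi.symm)⟩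
  · exact ⟨_, stage2_free hi hf⟩

theorem stage2_settled_eq (hP : c.Proper) (i : Fin k) :
    ((round L stage2Rule c).mem i).settled = (c.mem i).settled := by
  by_cases h : (c.mem i).settled = true
  · rw [h, (stage2_settled hP h).2.1]
  · obtain ⟨p, hp⟩ := stage2_moves (L := L) hP (by simpa using h)
    rw [hp.mem]

theorem stage2_proper (hP : c.Proper) : (round L stage2Rule c).Proper := by
  intro i j hi hj hij
  rw [stage2_settled_eq hP] at hi hj
  rw [(stage2_settled hP hi).1, (stage2_settled hP hj).1] at hij
  exact hP i j hi hj hij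

theorem stage2_hosts (hP : c.Proper) : (round L stage2Rule c).hosts = c.hosts := by
  ext v
  simp only [mem_hosts, stage2_settled_eq hP]
  constructor
  · rintro ⟨r, hr, rfl⟩
    exact ⟨r, hr, ((stage2_settled hP hr).1).symm⟩
  · rintro ⟨r, hr, rfl⟩
    exact ⟨r, hr, (stage2_settled hP hr).1⟩

/-! ### The gathering of a component in Stage 2 -/

/-- The robot `i` belongs to the component of `v`: it is there, or it is at a free node and is about
to go back there. -/
def Config.Belongs (c : Config V k) (L : PortLabelling G) (S : Finset V) (i : Fin k) (v : V) :
    Prop :=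
  Linked G S v (c.pos i) ∨
    c.pos i ∉ S ∧ ∃ w q, L.exit (c.pos i) (c.mem i).entered = some (w, q) ∧ Linked G S v w

theorem Config.Belongs.linked {S : Finset V} {v : V} (h : c.Belongs L S i v) (hi : c.pos i ∈ S) :
    Linked G S v (c.pos i) :=
  h.resolve_right fun h => h.1 hi

theorem Config.Belongs.round (hP : c.Proper) (hi : (c.mem i).settled = false) {v : V}
    (h : c.Belongs L c.hosts i v) : (round L stage2Rule c).Belongs L c.hosts i v := by
  by_cases hf : c.pos i ∈ c.hosts
  · have h := h.linked hf
    obtain ⟨p, hp⟩ := stage2_moves (L := L) hP hi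
    unfold Config.Belongs
    rw [hp.mem, hp.pos]
    rcases move_cases L (c.pos i) (c.mem i).entered p with h1 | h1
    · rw [h1]
      exact Or.inl h
    · by_cases h2 : (L.move (c.pos i) (c.mem i).entered p).1 ∈ c.hosts
      · exact Or.inl (h.tail (exit_adj h1) h2)
      · exact Or.inr ⟨h2, _, _, exit_symm h1, h⟩
  · rcases h with h | ⟨-, w, q, h1, h2⟩
    · exact absurd h.right hf
    · have hp := stage2_free (L := L) hi hf
      left
      rw [hp.pos, move_of_exit _ h1]
      exact h2

/-- Where the robots of the component of `root` are while `s` is the state of the search that gathers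
them: with the agent, gathered at the root, at a node that is not finished, or at a free node from
which they are about to go back to a node that is not visited. -/
def Config.Awaits (c : Config V k) (L : PortLabelling G) (S : Finset V) (root : V) (s : Search V)
    (i : Fin k) : Prop :=
  (c.pos i = s.head ∧ (s.head ∉ S → (c.mem i).entered = s.ent)) ∨
  c.pos i = root ∨
  (c.pos i ∈ S ∧ (c.pos i ∈ s.vis → s.ch (c.pos i) ≤ G.degree (c.pos i))) ∨
  (c.pos i ∉ S ∧ ∃ v q, L.exit (c.pos i) (c.mem i).entered = some (v, q) ∧ v ∉ s.vis)

/-- The robot `x`, of highest priority in the component of its home node `root`, performs the search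
`s` of this component. Here `orig` gives the positions at the start of the stage. -/
structure Gather (L : PortLabelling G) (orig : Fin k → V) (x : Fin k) (c : Config V k)
    (s : Search V) : Prop where
  proper : c.Proper
  unsettled : (c.mem x).settled = false
  belongs : ∀ i, (c.mem i).settled = false → c.Belongs L c.hosts i (orig i)
  pos : c.pos x = s.head
  ent : (c.mem x).entered = s.ent
  home : ∃ h, (c.mem h).settled = true ∧ c.pos h = orig x ∧ (c.mem x).home = h
  top : ∀ i, (c.mem i).settled = false → Linked G c.hosts (orig x) (orig i) → i ≠ x →
    c.prio i < c.prio x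
  linked : ∀ v ∈ s.vis, Linked G c.hosts (orig x) v
  vis : ∀ r, (c.mem r).settled = true → c.pos r ∈ s.vis → (c.mem r).treelabel = x ∧
    (c.mem r).mult = (c.mem x).mult ∧ (c.mem r).parent = s.par (c.pos r) ∧
    (c.mem r).child = s.ch (c.pos r)
  unvis : ∀ r, (c.mem r).settled = true → c.pos r ∉ s.vis → c.pos r ≠ orig x →
    Linked G c.hosts (orig x) (c.pos r) → c.hostPrio r < c.prio x
  start : ∀ r, (c.mem r).settled = true → c.pos r = orig x → orig x ∉ s.vis →
    (c.mem r).treelabel = x ∧ (c.mem r).mult = (c.mem x).mult ∧ (c.mem r).parent = 0 ∧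
    (c.mem r).child = 0
  awaits : ∀ i, (c.mem i).settled = false → Linked G c.hosts (orig x) (orig i) →
    c.Awaits L c.hosts (orig x) s i

variable {orig : Fin k → V} {s : Search V} {t : ℕ}

theorem Search.Timed.fresh_of {S : Finset V} {root : V} (ht : s.Timed L S root t)
    (h : root ∉ s.vis) : s.Fresh root := by
  rcases ht with h' | h' | h' | h'
  · exact h'.1
  · exact absurd h'.1.root_vis h
  · exact absurd h'.1.root_vis h
  · exact absurd h'.root_vis h

/-- The visitors of a node of the component belong to the component. -/
theorem Gather.linked_orig (h : Gather L orig x c s) (hi : (c.mem i).settled = false)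
    (hl : Linked G c.hosts (orig x) (c.pos i)) : Linked G c.hosts (orig x) (orig i) :=
  hl.trans ((h.belongs i hi).linked hl.right).symm

theorem Gather.prio_lt (h : Gather L orig x c s) (hi : (c.mem i).settled = false)
    (hl : Linked G c.hosts (orig x) (c.pos i)) (hix : i ≠ x) : c.prio i < c.prio x :=
  h.top i hi (h.linked_orig hi hl) hix

theorem Gather.head_linked (h : Gather L orig x c s) (hS : s.head ∈ c.hosts) :
    Linked G c.hosts (orig x) s.head := by
  have := h.belongs x h.unsettled
  rw [← h.pos] at hS ⊢
  exact this.linked hS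

theorem Gather.tops (h : Gather L orig x c s) (hS : s.head ∈ c.hosts) : c.Tops x := by
  refine ⟨h.unsettled, fun y hy hy' => ?_⟩
  by_cases hyx : y = x
  · rw [hyx]
  · refine (h.prio_lt hy' ?_ hyx).le
    rw [hy, h.pos]
    exact h.head_linked hS

/-- Away from the agent, visited nodes do not change. -/
theorem Gather.away_vis (h : Gather L orig x c s) (hr : (c.mem r).settled = true)
    (hv : c.pos r ∈ s.vis) (hh : c.pos r ≠ s.head) :
    (round L stage2Rule c).mem r = c.mem r ∧
      ∀ i, (c.mem i).settled = false → c.pos i = c.pos r →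
        (round L stage2Rule c).pos i = c.pos r := by
  obtain ⟨h1, h2, -⟩ := h.vis r hr hv
  have hlow : ∀ y, c.Tops y → c.pos y = c.pos r → c.prio y < c.hostPrio r := by
    intro y hy hyr
    have : c.hostPrio r = c.prio x := by rw [Config.hostPrio, Config.prio, h1, h2]
    rw [this]
    refine h.prio_lt hy.1 (hyr ▸ h.linked _ hv) ?_
    rintro rfl
    exact hh (hyr.symm.trans h.pos)
  constructor
  · obtain ⟨-, -, h3⟩ := stage2_settled (L := L) h.proper hr
    rcases h3 with ⟨h3, -⟩ | ⟨y, hy, hyr, -, -, h4⟩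
    · exact h3
    · have := hlow y hy hyr
      rcases h4 with ⟨h4, -⟩ | ⟨h4, -⟩
      · exact absurd h4 this.ne
      · exact absurd h4 this.not_gt
  · intro i hi hir
    obtain ⟨y, hy, hyi⟩ := exists_tops hi
    have := stage2_host (L := L) h.proper hy hi hyi.symm hr (hir.symm.trans hyi.symm)
    rw [Config.hostPort2, if_pos (hlow y hy (hyi.trans hir))] at this
    rw [this.pos, move_zero, hir]

/-- Away from the agent, the settled robots of unvisited nodes keep a low priority. -/
theorem Gather.away_unvis (h : Gather L orig x c s) (hr : (c.mem r).settled = true)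
    (hv : c.pos r ∉ s.vis) (hh : c.pos r ≠ s.head) (hx : c.pos r ≠ orig x)
    (hl : Linked G c.hosts (orig x) (c.pos r)) :
    (round L stage2Rule c).hostPrio r < c.prio x := by
  obtain ⟨-, -, h3⟩ := stage2_settled (L := L) h.proper hr
  rcases h3 with ⟨h3, -⟩ | ⟨y, hy, hyr, h4, h5, -⟩
  · rw [Config.hostPrio, h3]
    exact h.unvis r hr hv hx hl
  · rw [Config.hostPrio, h4, h5]
    refine h.prio_lt hy.1 (hyr ▸ hl) ?_
    rintro rfl
    exact hh (hyr.symm.trans h.pos)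

/-- What happens at the node of the agent, if it is not free. -/
theorem Gather.at_head (h : Gather L orig x c s)
    (ht : s.Timed L c.hosts (orig x) t) (hd : 0 < G.degree (orig x)) (hS : s.head ∈ c.hosts) :
    (∀ r, (c.mem r).settled = true → c.pos r = s.head →
      ((round L stage2Rule c).mem r).treelabel = x ∧
      ((round L stage2Rule c).mem r).mult = (c.mem x).mult ∧
      ((round L stage2Rule c).mem r).parent = (s.step L c.hosts (orig x)).par s.head ∧
      ((round L stage2Rule c).mem r).child = (s.step L c.hosts (orig x)).ch s.head) ∧
    ∃ p, (s.step L c.hosts (orig x)).head = (L.move s.head s.ent p).1 ∧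
      (s.step L c.hosts (orig x)).ent = (L.move s.head s.ent p).2 ∧
      ∀ i, (c.mem i).settled = false → c.pos i = s.head →
        if i = x ∨ s.head ≠ orig x then Moves L c (round L stage2Rule c) i p
        else Moves L c (round L stage2Rule c) i 0 := by
  have hx := h.tops hS
  obtain ⟨r, hr, hrh⟩ := mem_hosts.1 hS
  have hrx : c.pos r = c.pos x := hrh.trans h.pos.symm
  suffices hmain : (((round L stage2Rule c).mem r).treelabel = x ∧
      ((round L stage2Rule c).mem r).mult = (c.mem x).mult ∧
      ((round L stage2Rule c).mem r).parent = (s.step L c.hosts (orig x)).par s.head ∧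
      ((round L stage2Rule c).mem r).child = (s.step L c.hosts (orig x)).ch s.head) ∧
      ∃ p, (s.step L c.hosts (orig x)).head = (L.move s.head s.ent p).1 ∧
      (s.step L c.hosts (orig x)).ent = (L.move s.head s.ent p).2 ∧
      ∀ i, (if i = x ∨ s.head ≠ orig x then p else 0) =
        c.hostPort2 (G.degree s.head) r x i by
    refine ⟨fun r' hr' hr'h => ?_, ?_⟩
    · rw [h.proper r' r hr' hr (hr'h.trans hrh.symm)]
      exact hmain.1
    · obtain ⟨p, h1, h2, h3⟩ := hmain.2
      refine ⟨p, h1, h2, fun i hi hih => ?_⟩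
      have hmv := stage2_host (L := L) h.proper hx hi (hih.trans h.pos.symm) hr hrx
      rw [h.pos, ← h3 i] at hmv
      split_ifs at hmv ⊢ with h4
      · exact hmv
      · exact hmv
  have hhome : (c.mem x).home = r ↔ s.head = orig x := by
    obtain ⟨b, hb1, hb2, hb3⟩ := h.home
    rw [hb3]
    constructor
    · intro hbr
      obtain rfl : b = r := by simpa using hbr
      rw [← hrh, hb2]
    · intro hh
      rw [h.proper b r hb1 hr (by rw [hb2, hrh, hh])]
  obtain ⟨-, -, hset⟩ := stage2_settled (L := L) h.proper hr
  by_cases heq : c.prio x = c.hostPrio r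
  · -- The node is served: it is visited, or it is the root at the very start.
    have hset' : ((round L stage2Rule c).mem r).treelabel = x ∧
        ((round L stage2Rule c).mem r).mult = (c.mem x).mult ∧
        ((round L stage2Rule c).mem r).parent = (c.mem r).parent ∧
        ((round L stage2Rule c).mem r).child =
          advance (G.degree s.head) (c.mem r) s.ent := by
      rcases hset with ⟨-, h1⟩ | ⟨y, hy, hyr, h1, h2, h3⟩
      · exact absurd heq (h1 x hx hrx.symm).ne
      · obtain rfl := hy.unique hx (hyr.trans hrx)
        rcases h3 with ⟨-, h3, h4⟩ | ⟨h3, -⟩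
        · rw [hrh, h.ent] at h4
          exact ⟨h1, h2, h3, h4⟩
        · exact absurd heq h3.ne'
    obtain ⟨h1, h2, h3, h4⟩ := hset'
    have hport : ∀ i, c.hostPort2 (G.degree s.head) r x i =
        if s.head = orig x then
          if i = x ∧ advance (G.degree s.head) (c.mem r) s.ent ≤ G.degree s.head then
            continuePort (G.degree s.head) (c.mem r) s.ent else 0
        else continuePort (G.degree s.head) (c.mem r) s.ent := by
      intro i
      rw [Config.hostPort2, if_neg (by rw [heq]; exact lt_irrefl _), if_pos heq, h.ent]
      simp only [hhome]
    by_cases hv : s.head ∈ s.vis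
    · obtain ⟨-, -, h5, h6⟩ := h.vis r hr (hrh ▸ hv)
      rw [hrh] at h5 h6
      rw [Search.step, if_pos hS, if_pos hv]
      have hadv : advance (G.degree s.head) (c.mem r) s.ent =
          if s.ent = s.par s.head ∨ s.ent = s.ch s.head then
            nextPort (G.degree s.head) (s.par s.head) (s.ch s.head) else s.ch s.head := by
        simp only [advance, h5, h6]
      have hcont : continuePort (G.degree s.head) (c.mem r) s.ent =
          if s.ent = s.par s.head ∨ s.ent = s.ch s.head then
            exitPort (G.degree s.head) (s.par s.head) (advance (G.degree s.head) (c.mem r) s.ent)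
          else s.ent := by
        rw [hadv]
        simp only [continuePort, h5, h6]
        split_ifs <;> rfl
      refine ⟨⟨h1, h2, by rw [h3, h5]; rfl, ?_⟩,
        if s.head = orig x ∧ G.degree s.head < advance (G.degree s.head) (c.mem r) s.ent then 0
          else continuePort (G.degree s.head) (c.mem r) s.ent, ?_, ?_, fun i => ?_⟩
      · rw [h4, hadv]
        simp [Search.continue]
      · rw [hcont, hadv]
        rfl
      · rw [hcont, hadv]
        rfl
      · rw [hport]
        by_cases hr1 : s.head = orig x
        · rw [if_pos hr1]
          by_cases hix : i = x
          · rw [if_pos (Or.inl hix)]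
            by_cases hle : advance (G.degree s.head) (c.mem r) s.ent ≤ G.degree s.head
            · rw [if_neg (fun h => not_lt.2 hle h.2), if_pos ⟨hix, hle⟩]
            · rw [if_pos ⟨hr1, not_le.1 hle⟩, if_neg (fun h => hle h.2)]
          · rw [if_neg (fun h => h.elim hix fun h => h hr1), if_neg (fun h => hix h.1)]
        · rw [if_pos (Or.inr hr1), if_neg (fun h => hr1 h.1), if_neg hr1]
    · have hr1 : s.head = orig x := by
        by_contra hr1
        exact (h.unvis r hr (hrh ▸ hv) (by rwa [hrh]) (hrh ▸ h.head_linked hS)).ne heq.symm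
      have hF := ht.fresh_of (hr1 ▸ hv)
      obtain ⟨-, -, h5, h6⟩ := h.start r hr (hrh.trans hr1) (hr1 ▸ hv)
      have hent := hF.ent
      rw [Search.step, if_pos hS, if_neg hv]
      refine ⟨⟨h1, h2, ?_, ?_⟩, _, rfl, rfl, fun i => ?_⟩
      · rw [h3, h5]
        simp [Search.adopt, hent]
      · rw [h4]
        simp [Search.adopt, advance, h5, h6, hent]
      · have hle : nextPort (G.degree s.head) 0 0 ≤ G.degree s.head := by
          rw [hr1]
          simpa [nextPort] using Nat.succ_le_of_lt hd
        have hadv : advance (G.degree s.head) (c.mem r) s.ent =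
            nextPort (G.degree s.head) 0 0 := by
          simp [advance, h5, h6, hent]
        have hcont : continuePort (G.degree s.head) (c.mem r) s.ent =
            exitPort (G.degree s.head) s.ent (nextPort (G.degree s.head) s.ent 0) := by
          simp [continuePort, h5, h6, hent]
        rw [hport, if_pos hr1, hadv, hcont]
        by_cases hix : i = x
        · rw [if_pos (Or.inl hix), if_pos ⟨hix, hle⟩]
        · rw [if_neg (fun h => h.elim hix fun h => h hr1), if_neg (fun h => hix h.1)]
  · have hlt : c.hostPrio r < c.prio x := by
      by_cases hv : s.head ∈ s.vis
      · obtain ⟨h1, h2, -⟩ := h.vis r hr (hrh ▸ hv)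
        exact absurd (by rw [Config.prio, Config.hostPrio, h1, h2]) heq
      · by_cases hr1 : s.head = orig x
        · obtain ⟨h1, h2, -⟩ := h.start r hr (hrh.trans hr1) (hr1 ▸ hv)
          exact absurd (by rw [Config.prio, Config.hostPrio, h1, h2]) heq
        · exact h.unvis r hr (hrh ▸ hv) (by rwa [hrh]) (hrh ▸ h.head_linked hS)
    have hv : s.head ∉ s.vis := by
      intro hv
      obtain ⟨h1, h2, -⟩ := h.vis r hr (hrh ▸ hv)
      exact absurd (by rw [Config.prio, Config.hostPrio, h1, h2]) heq
    have hr1 : s.head ≠ orig x := by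
      intro hr1
      obtain ⟨h1, h2, -⟩ := h.start r hr (hrh.trans hr1) (hr1 ▸ hv)
      exact absurd (by rw [Config.prio, Config.hostPrio, h1, h2]) heq
    rw [Search.step, if_pos hS, if_neg hv]
    refine ⟨?_, _, rfl, rfl, fun i => ?_⟩
    · rcases hset with ⟨-, h1⟩ | ⟨y, hy, hyr, h1, h2, h3⟩
      · exact absurd hlt (h1 x hx hrx.symm).not_gt
      · obtain rfl := hy.unique hx (hyr.trans hrx)
        rcases h3 with ⟨h3, -⟩ | ⟨-, h3, h4⟩
        · exact absurd h3 heq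
        · rw [hrh, h.ent] at h4
          rw [h.ent] at h3
          exact ⟨h1, h2, by simp [Search.adopt, h3], by simp [Search.adopt, h4]⟩
    · rw [if_pos (Or.inr hr1), Config.hostPort2, if_neg hlt.not_gt, if_neg heq, h.ent]

end Stage2

/-! ### The search that gathers a component, round by round -/

section Stage2

variable {V : Type*} [Fintype V] [DecidableEq V] {G : SimpleGraph V} [DecidableRel G.Adj]
  {L : PortLabelling G} {k : ℕ} {c : Config V k} {x i r : Fin k}
variable {orig : Fin k → V} {s : Search V} {t : ℕ}

theorem Search.step_vis (S : Finset V) (root : V) :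
    (s.step L S root).vis = if s.head ∈ S then insert s.head s.vis else s.vis := by
  unfold Search.step
  split_ifs with h1 h2
  · simp [Search.continue, h2]
  · rfl
  · rfl

theorem Search.step_of_ne (S : Finset V) (root : V) {v : V} (hv : v ≠ s.head) :
    (s.step L S root).par v = s.par v ∧ (s.step L S root).ch v = s.ch v := by
  unfold Search.step
  split_ifs with h1 h2
  · simp [Search.continue, hv]
  · simp [Search.adopt, hv]
  · exact ⟨rfl, rfl⟩

theorem stage2_mult_home (hP : c.Proper) (hi : (c.mem i).settled = false) :
    ((round L stage2Rule c).mem i).mult = (c.mem i).mult ∧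
      ((round L stage2Rule c).mem i).home = (c.mem i).home := by
  obtain ⟨p, hp⟩ := stage2_moves (L := L) hP hi
  rw [hp.mem]
  exact ⟨rfl, rfl⟩

/-- The agent of the search is the robot `x`, and its companions move with it, except that they remain
at the root. -/
theorem Gather.move (h : Gather L orig x c s)
    (ht : s.Timed L c.hosts (orig x) t) (hd : 0 < G.degree (orig x)) :
    (round L stage2Rule c).pos x = (s.step L c.hosts (orig x)).head ∧
    ((round L stage2Rule c).mem x).entered = (s.step L c.hosts (orig x)).ent ∧
    ∀ i, (c.mem i).settled = false → c.pos i = s.head →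
      (s.head ∉ c.hosts → (c.mem i).entered = s.ent) → (round L stage2Rule c).pos i = orig x ∨
      (round L stage2Rule c).pos i = (s.step L c.hosts (orig x)).head ∧
      ((s.step L c.hosts (orig x)).head ∉ c.hosts →
        ((round L stage2Rule c).mem i).entered = (s.step L c.hosts (orig x)).ent) := by
  by_cases hS : s.head ∈ c.hosts
  · obtain ⟨-, p, h1, h2, h3⟩ := h.at_head ht hd hS
    have hx := h3 x h.unsettled h.pos
    rw [if_pos (Or.inl rfl)] at hx
    rw [h1, h2, hx.mem, hx.pos, h.pos, h.ent]
    refine ⟨rfl, rfl, fun i hi hih _ => ?_⟩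
    have h4 := h3 i hi hih
    split_ifs at h4 with h5
    · right
      rw [h4.mem, h4.pos, hih]
      rcases move_cases L s.head s.ent p with h6 | h6
      · rw [h6]
        refine ⟨?_, fun h => absurd hS h⟩
        rw [fst_move_congr s.head _ s.ent p, h6]
      · rw [move_of_exit _ h6]
        exact ⟨rfl, fun _ => rfl⟩
    · left
      rw [h4.pos, move_zero, hih]
      by_contra h6
      exact h5 (Or.inr h6)
  · have h1 : s.step L c.hosts (orig x) = s.bounce L := by rw [Search.step, if_neg hS]
    have hx := stage2_free (L := L) h.unsettled (by rwa [h.pos])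
    rw [h1, hx.mem, hx.pos, h.pos, h.ent]
    refine ⟨rfl, rfl, fun i hi hih hie => ?_⟩
    have hi' := stage2_free (L := L) hi (by rwa [hih])
    rw [hi'.mem, hi'.pos, hih, hie hS]
    exact Or.inr ⟨rfl, fun _ => rfl⟩

/-- Every robot of the component goes on waiting for the agent: a robot could only escape by moving to
a node that the agent has left for good, but then the agent has visited the node from which the
robot came, and the robot would have been stopped there. -/
theorem Gather.awaits_step (h : Gather L orig x c s) (hI : s.Inv L c.hosts (orig x))
    (ht : s.Timed L c.hosts (orig x) t) (hd : 0 < G.degree (orig x))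
    (hi : (c.mem i).settled = false) (hl : Linked G c.hosts (orig x) (orig i)) :
    (round L stage2Rule c).Awaits L c.hosts (orig x) (s.step L c.hosts (orig x)) i := by
  have hI' := (Search.step_inv hI ht hd).1
  have hvis' : ∀ v, v ∈ (s.step L c.hosts (orig x)).vis → v ≠ s.head → v ∈ s.vis := by
    intro v hv hvh
    rw [Search.step_vis] at hv
    split_ifs at hv
    · exact (Finset.mem_insert.1 hv).resolve_left hvh
    · exact hv
  have hmain : c.pos i ∈ c.hosts → c.pos i ≠ s.head →
      (c.pos i ∈ s.vis → s.ch (c.pos i) ≤ G.degree (c.pos i) ∨ c.pos i = orig x) →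
      (round L stage2Rule c).Awaits L c.hosts (orig x) (s.step L c.hosts (orig x)) i := by
    intro hS hih hopen
    by_cases hv : c.pos i ∈ s.vis
    · obtain ⟨r, hr, hri⟩ := mem_hosts.1 hS
      have h1 := (h.away_vis (L := L) hr (hri ▸ hv) (hri ▸ hih)).2 i hi hri.symm
      rw [hri] at h1
      rcases hopen hv with h2 | h2
      · refine Or.inr (Or.inr (Or.inl ⟨h1 ▸ hS, fun _ => ?_⟩))
        rw [h1, (Search.step_of_ne _ _ hih).2]
        exact h2
      · exact Or.inr (Or.inl (h1.trans h2))
    · have hv' : c.pos i ∉ (s.step L c.hosts (orig x)).vis := fun h => hv (hvis' _ h hih)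
      obtain ⟨p, hp⟩ := stage2_moves (L := L) h.proper hi
      rcases move_cases L (c.pos i) (c.mem i).entered p with h1 | h1
      · refine Or.inr (Or.inr (Or.inl ?_))
        rw [hp.pos, h1]
        exact ⟨hS, fun h => absurd h hv'⟩
      · by_cases h2 : (L.move (c.pos i) (c.mem i).entered p).1 ∈ c.hosts
        · refine Or.inr (Or.inr (Or.inl ?_))
          rw [hp.pos]
          refine ⟨h2, fun h3 => ?_⟩
          by_contra! h4
          have h5 := exit_symm h1
          exact hv' (hI'.explored _ h3 _ _ _ ((exit_bounds h5).2.trans_lt h4) h5 hS)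
        · refine Or.inr (Or.inr (Or.inr ?_))
          rw [hp.pos, hp.mem]
          exact ⟨h2, _, _, exit_symm h1, hv'⟩
  have hwith : c.pos i = s.head → (s.head ∉ c.hosts → (c.mem i).entered = s.ent) →
      (round L stage2Rule c).Awaits L c.hosts (orig x) (s.step L c.hosts (orig x)) i := by
    intro h1 h2
    rcases (h.move ht hd).2.2 i hi h1 h2 with h3 | h3
    · exact Or.inr (Or.inl h3)
    · exact Or.inl h3
  rcases h.awaits i hi hl with ⟨h1, h2⟩ | h1 | ⟨h1, h2⟩ | ⟨h1, v, q, h2, h3⟩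
  · exact hwith h1 h2
  · by_cases h2 : c.pos i = s.head
    · exact hwith h2 fun h3 => absurd hI.root_mem (by rwa [← h1, h2])
    · exact hmain (h1 ▸ hI.root_mem) h2 fun _ => Or.inr h1
  · by_cases h3 : c.pos i = s.head
    · exact hwith h3 fun h4 => absurd h1 (h3 ▸ h4)
    · exact hmain h1 h3 fun h => Or.inl (h2 h)
  · have hp := stage2_free (L := L) hi h1
    have hvS : v ∈ c.hosts := by
      rcases h.belongs i hi with h4 | ⟨-, w, q', h4, h5⟩
      · exact absurd h4.right h1
      · rw [h2] at h4
        simp only [Option.some.injEq, Prod.mk.injEq] at h4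
        exact h4.1 ▸ h5.right
    have hpos : (round L stage2Rule c).pos i = v := by rw [hp.pos, move_of_exit _ h2]
    by_cases hr : v = orig x
    · exact Or.inr (Or.inl (hpos.trans hr))
    refine Or.inr (Or.inr (Or.inl ?_))
    rw [hpos]
    refine ⟨hvS, fun h4 => ?_⟩
    by_cases h5 : v = s.head
    · subst h5
      have hF : s.Forward L (orig x) := by
        rcases ht with h' | h' | h' | h'
        · exact absurd h'.1.head hr
        · exact h'.1
        · exact absurd h'.1.head_vis h3
        · exact absurd h'.head hr
      rw [Search.step, if_pos hvS, if_neg h3]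
      simp only [Search.adopt, Function.update_self]
      by_contra! h6
      have h7 := exit_symm h2
      have h8 := exit_bounds h7
      -- The port to the free node is not the parent port, so the node has a port to be explored.
      have h9 := eq_parent_of_lt_nextPort (by omega) (lt_of_le_of_lt h8.2 h6)
      obtain ⟨w, b, h10, h11, -⟩ := hF.from_vis
      rw [← h9, h7] at h10
      simp only [Option.some.injEq, Prod.mk.injEq] at h10
      exact h1 (h10.1 ▸ hI.vis_sub h11)
    · exact absurd (hvis' _ h4 h5) h3

theorem Gather.step (h : Gather L orig x c s) (hI : s.Inv L c.hosts (orig x))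
    (ht : s.Timed L c.hosts (orig x) t) (hd : 0 < G.degree (orig x)) :
    Gather L orig x (round L stage2Rule c) (s.step L c.hosts (orig x)) := by
  have hset := stage2_settled_eq (L := L) h.proper
  have hhosts := stage2_hosts (L := L) h.proper
  have hmv := h.move ht hd
  have hprio : ∀ i, (c.mem i).settled = false →
      (round L stage2Rule c).prio i = c.prio i := by
    intro i hi
    rw [Config.prio, Config.prio, (stage2_mult_home h.proper hi).1]
  have hpos : ∀ r, (c.mem r).settled = true → (round L stage2Rule c).pos r = c.pos r :=
    fun r hr => (stage2_settled h.proper hr).1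
  have hvis : ∀ r, (c.mem r).settled = true → c.pos r ∈ (s.step L c.hosts (orig x)).vis →
      c.pos r ≠ s.head → c.pos r ∈ s.vis := by
    intro r _ hv hvh
    rw [Search.step_vis] at hv
    split_ifs at hv
    · exact (Finset.mem_insert.1 hv).resolve_left hvh
    · exact hv
  constructor
  · exact stage2_proper h.proper
  · rw [hset]
    exact h.unsettled
  · intro i hi
    rw [hset] at hi
    rw [hhosts]
    exact (h.belongs i hi).round h.proper hi
  · exact hmv.1
  · exact hmv.2.1
  · obtain ⟨b, h1, h2, h3⟩ := h.home
    refine ⟨b, by rw [hset]; exact h1, by rw [hpos b h1]; exact h2, ?_⟩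
    rw [(stage2_mult_home h.proper h.unsettled).2]
    exact h3
  · intro i hi hl hix
    rw [hset] at hi
    rw [hhosts] at hl
    rw [hprio i hi, hprio x h.unsettled]
    exact h.top i hi hl hix
  · intro v hv
    rw [hhosts]
    rw [Search.step_vis] at hv
    split_ifs at hv with hS
    · rcases Finset.mem_insert.1 hv with rfl | hv
      · exact h.head_linked hS
      · exact h.linked v hv
    · exact h.linked v hv
  · intro r hr hv
    rw [hset] at hr
    rw [hpos r hr] at hv ⊢
    rw [(stage2_mult_home h.proper h.unsettled).1]
    by_cases hh : c.pos r = s.head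
    · have hS : s.head ∈ c.hosts := mem_hosts.2 ⟨r, hr, hh⟩
      have := (h.at_head ht hd hS).1 r hr hh
      rwa [← hh] at this
    · have hv' := hvis r hr hv hh
      obtain ⟨h1, h2⟩ := Search.step_of_ne (L := L) c.hosts (orig x) hh
      rw [(h.away_vis hr hv' hh).1, h1, h2]
      exact h.vis r hr hv'
  · intro r hr hv hx hl
    rw [hset] at hr
    rw [hpos r hr] at hv hx hl
    rw [hhosts] at hl
    rw [hprio x h.unsettled]
    rw [Search.step_vis] at hv
    split_ifs at hv with hS
    · rw [Finset.mem_insert, not_or] at hv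
      exact h.away_unvis hr hv.2 hv.1 hx hl
    · refine h.away_unvis hr hv ?_ hx hl
      rintro hh
      exact hS (mem_hosts.2 ⟨r, hr, hh⟩)
  · intro r hr hx hv
    -- The search begins with a visit to the root.
    exfalso
    rw [Search.step_vis] at hv
    split_ifs at hv with hS
    · rw [Finset.mem_insert, not_or] at hv
      exact hv.1 (ht.fresh_of hv.2).head.symm
    · exact hS ((ht.fresh_of hv).head ▸ hI.root_mem)
  · intro i hi hl
    rw [hset] at hi
    rw [hhosts] at hl ⊢
    exact h.awaits_step hI ht hd hi hl

theorem Gather.iterate (h : Gather L orig x c (Search.init (orig x)))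
    (hr : orig x ∈ c.hosts) (hd : 0 < G.degree (orig x)) (t : ℕ) :
    ((round L stage2Rule)^[t] c).hosts = c.hosts ∧
      Gather L orig x ((round L stage2Rule)^[t] c) (search L c.hosts (orig x) t) := by
  induction t with
  | zero => exact ⟨rfl, h⟩
  | succ t ih =>
    obtain ⟨ih1, ih2⟩ := ih
    obtain ⟨hI, hT⟩ := search_inv (L := L) hr hd t
    rw [iterate_round_succ, search_succ]
    refine ⟨(stage2_hosts ih2.proper).trans ih1, ?_⟩
    have := ih2.step (by rwa [ih1]) (by rwa [ih1]) hd
    rwa [ih1] at this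

/-- At the end of the search all unsettled robots of the component are at the root. -/
theorem Gather.final (h : Gather L orig x c (Search.init (orig x)))
    (hr : orig x ∈ c.hosts) (hd : ∀ v, 0 < G.degree v)
    (hi : (((round L stage2Rule)^[stageBound G k + 1] c).mem i).settled = false)
    (hl : Linked G c.hosts (orig x) (orig i)) :
    ((round L stage2Rule)^[stageBound G k + 1] c).pos i = orig x := by
  obtain ⟨h1, h2⟩ := h.iterate hr (hd _) (stageBound G k + 1)
  obtain ⟨hI, -⟩ := search_inv (L := L) hr (hd _) (stageBound G k + 1)
  have hC := search_complete (L := L) hr hd (k := k)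
    ((Finset.card_le_card hI.vis_sub).trans card_hosts_le)
  have hb := h2.belongs i hi
  rw [h1] at hb
  rcases h2.awaits i hi (by rwa [h1]) with ⟨h3, -⟩ | h3 | ⟨h3, h4⟩ | ⟨h3, v, q, h4, h5⟩
  · rw [h3, hC.head]
  · exact h3
  · rw [h1] at h3
    have h5 := hC.mem_vis_of_linked hI (hl.trans (hb.linked h3))
    exact absurd (h4 h5) (not_le.2 (hC.closed _ h5))
  · rw [h1] at h3
    rcases hb with hb | ⟨-, w, q', h6, h7⟩
    · exact absurd hb.right h3
    · rw [h4] at h6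
      simp only [Option.some.injEq, Prod.mk.injEq] at h6
      exact absurd (hC.mem_vis_of_linked hI (hl.trans (h6.1 ▸ h7))) h5

end Stage2

/-! ### The beginning and the end of Stage 2 -/

section Prepare

variable {V : Type*} [Fintype V] [DecidableEq V] {G : SimpleGraph V} [DecidableRel G.Adj]
  {L : PortLabelling G} {k : ℕ} {c : Config V k} {x i r : Fin k}

theorem prepare_basic (c : Config V k) (i : Fin k) :
    ((prepareStage2 c).mem i).settled = (c.mem i).settled ∧
    ((prepareStage2 c).mem i).entered = 0 ∧
    ((prepareStage2 c).mem i).mult = (c.at (c.pos i)).card := by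
  simp only [prepareStage2]
  split <;> split_ifs <;> exact ⟨rfl, rfl, rfl⟩

theorem prepare_leads (hP : c.Proper) (hx : c.Leads x) (hr : (c.mem r).settled = true)
    (hrx : c.pos r = c.pos x) :
    ((prepareStage2 c).mem x).home = r ∧ ((prepareStage2 c).mem r).treelabel = x ∧
    ((prepareStage2 c).mem r).parent = 0 ∧ ((prepareStage2 c).mem r).child = 0 := by
  have hxr : x ≠ r := by
    rintro rfl
    simp [hx.1] at hr
  simp only [prepareStage2, hrx, hx.lowestID rfl, lowestID_settledOf hP hr hrx, if_neg hxr, if_true,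
    and_self]

theorem prepare_hosts : (prepareStage2 c).hosts = c.hosts := by
  ext v
  simp only [mem_hosts, (prepare_basic c _).1]
  rfl

/-- In the component of `i`, the robot of highest priority is in the position to gather the others. -/
theorem exists_gather (hP : c.Proper)
    (hh : ∀ i, (c.mem i).settled = false → c.pos i ∈ c.hosts) (hi : (c.mem i).settled = false) :
    ∃ x, Linked G c.hosts (c.pos i) (c.pos x) ∧
      Gather L c.pos x (prepareStage2 c) (Search.init (c.pos x)) := by
  classical
  have hset := fun i => (prepare_basic c i).1
  have hmult := fun i => (prepare_basic c i).2.2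
  obtain ⟨x, hx, hmax⟩ := Finset.exists_max_image
    (Finset.univ.filter fun j => (c.mem j).settled = false ∧ Linked G c.hosts (c.pos i) (c.pos j))
    (prepareStage2 c).prio ⟨i, by simp [hi, Linked.refl (hh i hi)]⟩
  simp only [Finset.mem_filter, Finset.mem_univ, true_and] at hx hmax
  have htop : ∀ j, (c.mem j).settled = false → Linked G c.hosts (c.pos x) (c.pos j) → j ≠ x →
      (prepareStage2 c).prio j < (prepareStage2 c).prio x := fun j h1 h2 h3 =>
    lt_of_le_of_ne (hmax j ⟨h1, hx.2.trans h2⟩) fun h => h3 (prio_injective h)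
  have hlead : c.Leads x := by
    refine ⟨hx.1, fun y hy hy' => ?_⟩
    by_cases hyx : y = x
    · exact hyx.ge
    · have h := htop y hy' (by rw [hy]; exact Linked.refl (hh x hx.1)) hyx
      rcases priority_lt_iff.1 h with h | h
      · rw [hmult, hmult, hy] at h
        exact absurd h (lt_irrefl _)
      · exact (by simpa using h.2 : x < y).le
  obtain ⟨h, hh1, hh2⟩ := mem_hosts.1 (hh x hx.1)
  obtain ⟨hl1, hl2, hl3, hl4⟩ := prepare_leads hP hlead hh1 hh2
  refine ⟨x, hx.2, ?_⟩
  constructor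
  · intro a b ha hb hab
    rw [hset] at ha hb
    exact hP a b ha hb hab
  · rw [hset]
    exact hx.1
  · intro j hj
    rw [hset] at hj
    rw [prepare_hosts]
    exact Or.inl (Linked.refl (hh j hj))
  · rfl
  · exact (prepare_basic c x).2.1
  · exact ⟨h, by rw [hset]; exact hh1, hh2, hl1⟩
  · intro j hj hl hjx
    rw [hset] at hj
    rw [prepare_hosts] at hl
    exact htop j hj hl hjx
  · intro v hv
    simp [Search.init] at hv
  · intro r _ hv
    simp [Search.init] at hv
  · intro r hr _ hrx hl
    rw [hset] at hr
    rw [prepare_hosts] at hl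
    have hrx : c.pos r ≠ c.pos x := hrx
    by_cases hu : ∃ y, c.pos y = c.pos r ∧ (c.mem y).settled = false
    · obtain ⟨y, hy, hy'⟩ := hu
      obtain ⟨z, hz, hzy⟩ := exists_leads hy'
      have hzr : c.pos r = c.pos z := (hzy.trans hy).symm
      have h1 := (prepare_leads hP hz hr hzr).2.1
      have : (prepareStage2 c).hostPrio r = (prepareStage2 c).prio z := by
        rw [Config.hostPrio, Config.prio, h1, hmult, hmult, hzr]
      rw [this]
      refine htop z hz.1 (hzr ▸ hl) ?_
      rintro rfl
      exact hrx hzr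
    · -- A settled robot alone at its node has multiplicity `1`, less than that of `x`.
      push Not at hu
      refine priority_lt_iff.2 (Or.inl ?_)
      rw [hmult, hmult]
      have h1 : c.at (c.pos r) = {r} := by
        ext y
        rw [mem_at, Finset.mem_singleton]
        constructor
        · intro hy
          exact hP y r (by simpa using hu y hy) hr hy
        · rintro rfl
          rfl
      rw [h1, Finset.card_singleton, Finset.one_lt_card]
      refine ⟨x, mem_at.2 rfl, h, mem_at.2 hh2, ?_⟩
      rintro rfl
      simp [hx.1] at hh1
  · intro r hr hrx _
    rw [hset] at hr
    obtain rfl := hP r h hr hh1 (hrx.trans hh2.symm)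
    refine ⟨hl2, ?_, hl3, hl4⟩
    rw [hmult, hmult, hh2]
  · intro j hj _
    rw [hset] at hj
    rw [prepare_hosts]
    exact Or.inr (Or.inr (Or.inl ⟨hh j hj, fun h => by simp [Search.init] at h⟩))

theorem stage2_iterate (hP : c.Proper) (t : ℕ) : ((round L stage2Rule)^[t] c).Proper ∧
    ∀ i, (((round L stage2Rule)^[t] c).mem i).settled = (c.mem i).settled := by
  induction t with
  | zero => exact ⟨hP, fun _ => rfl⟩
  | succ t ih =>
    rw [iterate_round_succ]
    exact ⟨stage2_proper ih.1, fun i => (stage2_settled_eq ih.1 i).trans (ih.2 i)⟩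

theorem prepare_proper (hP : c.Proper) : (prepareStage2 c).Proper := by
  intro i j hi hj hij
  rw [(prepare_basic c _).1] at hi hj
  exact hP i j hi hj hij

theorem stage2_settled_iff (hP : c.Proper) (i : Fin k) :
    ((stage2 L c).mem i).settled = (c.mem i).settled :=
  ((stage2_iterate (prepare_proper hP) _).2 i).trans (prepare_basic c i).1

theorem stage2_blank (hP : c.Proper) : (stage2 L c).Blank where
  proper i j hi hj hij := (stage2_iterate (L := L) (prepare_proper hP) _).1 i j hi hj hij
  treelabel _ := rfl
  entered _ := rfl

/-- Stage 2 gathers the unsettled robots of each component at one of its nodes. -/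
theorem stage2_gathers (hP : c.Proper) (hd : ∀ v, 0 < G.degree v)
    (hh : ∀ i, (c.mem i).settled = false → c.pos i ∈ c.hosts) (hi : (c.mem i).settled = false) :
    ∃ v, ∀ j, (c.mem j).settled = false → Linked G c.hosts (c.pos i) (c.pos j) →
      (stage2 L c).pos j = v := by
  obtain ⟨x, hx, hg⟩ := exists_gather (L := L) hP hh hi
  refine ⟨c.pos x, fun j hj hl => ?_⟩
  refine hg.final (by rw [prepare_hosts]; exact hx.right) hd ?_ ?_
  · rw [(stage2_iterate (prepare_proper hP) _).2, (prepare_basic c j).1]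
    exact hj
  · rw [prepare_hosts]
    exact hx.symm.trans hl

end Prepare

/-! ### The passes -/

section Passes

variable {V : Type*} [Fintype V] [DecidableEq V] {G : SimpleGraph V} [DecidableRel G.Adj]
  {L : PortLabelling G} {k : ℕ} {c : Config V k}

/-- The nodes that hold unsettled robots. -/
def Config.groupNodes (c : Config V k) : Finset V :=
  Finset.univ.filter fun v : V => (unsettledOf (c.at v) c.mem).Nonempty

theorem mem_groupNodes {v : V} :
    v ∈ c.groupNodes ↔ ∃ i, (c.mem i).settled = false ∧ c.pos i = v := by
  simp only [Config.groupNodes, Finset.mem_filter, Finset.mem_univ, true_and, Finset.Nonempty,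
    mem_unsettledOf]

theorem groups_eq : c.groups = c.groupNodes.card := rfl

/-- A pass at least halves the number of groups: each group at its end comes from a component that
contains the starting nodes of two groups. -/
theorem two_mul_groups_le (hG : G.Connected) (hd : ∀ v, 0 < G.degree v)
    (hk : k ≤ Fintype.card V) (hB : c.Blank) :
    2 * (stage2 L (stage1 L c)).groups ≤ c.groups := by
  classical
  have hP := stage1_end_proper (L := L) hB
  have hend := fun i => stage1_end (L := L) (i := i) hG hd hk hB
  rw [groups_eq, groups_eq, mul_comm]
  have := Finset.card_mul_le_card_mul (s := (stage2 L (stage1 L c)).groupNodes)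
    (t := c.groupNodes) (m := 2) (n := 1)
    (fun b a => ∃ i, ((stage1 L c).mem i).settled = false ∧ (stage2 L (stage1 L c)).pos i = b ∧
      Linked G (stage1 L c).hosts ((stage1 L c).pos i) a) ?_ ?_
  · simpa using this
  · intro b hb
    obtain ⟨i, hi, hib⟩ := mem_groupNodes.1 hb
    rw [stage2_settled_iff hP] at hi
    obtain ⟨-, x, y, hx, hy, hxy, h1, h2⟩ := hend i hi
    refine Nat.succ_le_of_lt (Finset.one_lt_card.2 ⟨c.pos x, ?_, c.pos y, ?_, hxy⟩)
    · exact (Finset.mem_bipartiteAbove _).2 ⟨mem_groupNodes.2 ⟨x, hx.1, rfl⟩, i, hi, hib, h1⟩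
    · exact (Finset.mem_bipartiteAbove _).2 ⟨mem_groupNodes.2 ⟨y, hy.1, rfl⟩, i, hi, hib, h2⟩
  · intro a _
    refine Finset.card_le_one.2 fun b hb b' hb' => ?_
    obtain ⟨-, i, hi, hib, h1⟩ := (Finset.mem_bipartiteBelow _).1 hb
    obtain ⟨-, j, hj, hjb, h2⟩ := (Finset.mem_bipartiteBelow _).1 hb'
    obtain ⟨v, hv⟩ := stage2_gathers (L := L) hP hd (fun i hi => (hend i hi).1) hi
    rw [← hib, ← hjb, hv i hi (Linked.refl (hend i hi).1), hv j hj (h1.trans h2.symm)]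

/-- A single group disperses in Stage 1. -/
theorem stage1_dispersed (hG : G.Connected) (hd : ∀ v, 0 < G.degree v)
    (hk : k ≤ Fintype.card V) (hB : c.Blank) (hg : c.groups ≤ 1) : (stage1 L c).Dispersed := by
  have hall : ∀ i, ((stage1 L c).mem i).settled = true := by
    intro i
    by_contra hi
    obtain ⟨-, x, y, hx, hy, hxy, -⟩ := stage1_end (L := L) hG hd hk hB (by simpa using hi)
    rw [groups_eq] at hg
    exact hxy (Finset.card_le_one.1 hg _ (mem_groupNodes.2 ⟨x, hx.1, rfl⟩) _
      (mem_groupNodes.2 ⟨y, hy.1, rfl⟩))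
  exact ⟨hall, fun i j hij => stage1_end_proper hB i j (hall i) (hall j) hij⟩

theorem dispersed_of_settled (hB : c.Proper) (h : ∀ i, (c.mem i).settled = true) : c.Dispersed :=
  ⟨h, fun i j hij => hB i j (h i) (h j) hij⟩

theorem Config.Dispersed.proper (h : c.Dispersed) : c.Proper := fun _ _ _ _ hij => h.2 hij

theorem Config.Dispersed.groups_eq_zero (h : c.Dispersed) : c.groups = 0 := by
  rw [groups_eq, Finset.card_eq_zero, Finset.eq_empty_iff_forall_notMem]
  intro v hv
  obtain ⟨i, hi, -⟩ := mem_groupNodes.1 hv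
  rw [h.1 i] at hi
  cases hi

theorem Config.Dispersed.stage2 (h : c.Dispersed) : (stage2 L c).Dispersed :=
  dispersed_of_settled (stage2_blank h.proper).proper fun i => by
    rw [stage2_settled_iff h.proper, h.1 i]

theorem Config.Dispersed.stage1 (h : c.Dispersed) : (stage1 L c).Dispersed := by
  have hP := stage1_iterate_proper (L := L) h.proper
  refine dispersed_of_settled (hP _) ?_
  unfold Dispersion.stage1
  induction stageBound G k + 1 with
  | zero => exact h.1
  | succ t ih =>
    intro i
    rw [iterate_round_succ]
    exact (stage1_settled (hP t) (ih i)).2.1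

theorem start_blank (pos₀ : Fin k → V) : (start pos₀).Blank where
  proper i j hi _ hij := by
    simp only [start, decide_eq_true_eq] at hi hij
    exact (hi j hij.symm).symm
  treelabel _ := rfl
  entered _ := rfl

theorem afterPasses_succ (pos₀ : Fin k → V) (p : ℕ) :
    afterPasses L pos₀ (p + 1) = stage2 L (stage1 L (afterPasses L pos₀ p)) :=
  Function.iterate_succ_apply' _ _ _

theorem afterPasses_blank (pos₀ : Fin k → V) (p : ℕ) : (afterPasses L pos₀ p).Blank := by
  induction p with
  | zero => exact start_blank pos₀
  | succ p ih =>
    rw [afterPasses_succ]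
    exact stage2_blank (stage1_end_proper ih)

/-- Each group at the start has at least two robots. -/
theorem two_mul_groups_start_le (pos₀ : Fin k → V) : 2 * (start pos₀).groups ≤ k := by
  classical
  rw [groups_eq, mul_comm]
  have := Finset.card_mul_le_card_mul (s := (start pos₀).groupNodes)
    (t := (Finset.univ : Finset (Fin k))) (m := 2) (n := 1) (fun v i => pos₀ i = v) ?_ ?_
  · simpa using this
  · intro v hv
    obtain ⟨i, hi, hiv⟩ := mem_groupNodes.1 hv
    simp only [start, decide_eq_false_iff_not, not_forall] at hi hiv
    obtain ⟨j, hj, hji⟩ := hi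
    refine Nat.succ_le_of_lt (Finset.one_lt_card.2 ⟨j, ?_, i, ?_, hji⟩)
    · exact (Finset.mem_bipartiteAbove _).2 ⟨Finset.mem_univ _, hj.trans hiv⟩
    · exact (Finset.mem_bipartiteAbove _).2 ⟨Finset.mem_univ _, hiv⟩
  · intro i _
    refine Finset.card_le_one.2 fun b hb b' hb' => ?_
    rw [← ((Finset.mem_bipartiteBelow _).1 hb).2, ← ((Finset.mem_bipartiteBelow _).1 hb').2]

end Passes

end Dispersion

theorem mainTheorem2 {V : Type*} [Fintype V] [DecidableEq V]
    (G : SimpleGraph V) [DecidableRel G.Adj] (hG : G.Connected)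
    (L : Dispersion.PortLabelling G)
    (k : ℕ) (hk : k ≤ Fintype.card V) (pos₀ : Fin k → V) :
    (∀ p, 2 * (Dispersion.afterPasses L pos₀ (p + 1)).groups
        ≤ (Dispersion.afterPasses L pos₀ p).groups) ∧
    (∀ p, 1 ≤ p → Nat.log 2 k ≤ p →
      (Dispersion.afterPasses L pos₀ (p - 1)).groups ≤ 1 ∧
      (Dispersion.afterStage1 L pos₀ p).Dispersed) ∧
    (∀ p, Nat.log 2 k ≤ p → (Dispersion.afterPasses L pos₀ p).Dispersed) := by
  open Dispersion in
  rcases Nat.lt_or_ge 1 k with h2 | h2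
  · have : Nontrivial V := Fintype.one_lt_card_iff_nontrivial.1 (by omega)
    have hd : ∀ v, 0 < G.degree v := fun v => hG.preconnected.degree_pos_of_nontrivial v
    have hB := afterPasses_blank (L := L) pos₀
    have hhalf : ∀ p, 2 * (afterPasses L pos₀ (p + 1)).groups ≤ (afterPasses L pos₀ p).groups := by
      intro p
      rw [afterPasses_succ]
      exact two_mul_groups_le hG hd hk (hB p)
    have hpow : ∀ p, 2 ^ (p + 1) * (afterPasses L pos₀ p).groups ≤ k := by
      intro p
      induction p with
      | zero => simpa [afterPasses] using two_mul_groups_start_le pos₀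
      | succ p ih =>
        refine le_trans ?_ ih
        rw [pow_succ 2 (p + 1), mul_assoc]
        exact Nat.mul_le_mul_left _ (hhalf p)
    have hone : ∀ p, Nat.log 2 k ≤ p + 1 → (afterPasses L pos₀ p).groups ≤ 1 := by
      intro p hp
      have h3 : k < 2 ^ (p + 1 + 1) :=
        (Nat.lt_pow_succ_log_self one_lt_two k).trans_le
          (Nat.pow_le_pow_right two_pos (by omega))
      have h4 := (hpow p).trans_lt h3
      rw [pow_succ 2 (p + 1)] at h4
      have := Nat.lt_of_mul_lt_mul_left h4
      omega
    have hdisp : ∀ p, Nat.log 2 k ≤ p + 1 → (stage1 L (afterPasses L pos₀ p)).Dispersed :=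
      fun p hp => stage1_dispersed hG hd hk (hB p) (hone p hp)
    refine ⟨hhalf, fun p hp hlog => ?_, fun p hlog => ?_⟩
    · obtain ⟨q, rfl⟩ := Nat.exists_eq_add_of_le' hp
      exact ⟨hone q hlog, hdisp q hlog⟩
    · have : 0 < Nat.log 2 k := Nat.log_pos one_lt_two h2
      obtain ⟨q, rfl⟩ := Nat.exists_eq_add_of_le' (show 1 ≤ p by omega)
      rw [afterPasses_succ]
      exact (hdisp q hlog).stage2
  · -- At most one robot: it is settled from the start.
    have hsub : ∀ i j : Fin k, i = j := fun i j => Fin.ext (by omega)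
    have hD : ∀ p, (afterPasses L pos₀ p).Dispersed := by
      intro p
      induction p with
      | zero =>
        exact dispersed_of_settled (start_blank pos₀).proper fun i => by
          simpa [afterPasses, start] using fun j _ => hsub j i
      | succ p ih =>
        rw [afterPasses_succ]
        exact ih.stage1.stage2
    refine ⟨fun p => by rw [(hD _).groups_eq_zero]; simp, fun p _ _ => ⟨?_, ?_⟩, fun p _ => hD p⟩
    · rw [(hD _).groups_eq_zero]
      exact zero_le_one
    · exact (hD _).stage1
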